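/- \textbf{Definitions.} All sequences are sequences of positive integers. Let $S=(s_1,s_2,s_3,\dots)$ be infinite and suppose that every positive integer occurs in $S$. The \emph{upper trimmed} sequence $\wedge_S$ is what remains of $S$ when the first occurrence of every positive integer is removed. The \emph{lower trimmed} sequence $\vee_S$ is what remains when $1$ is subtracted from every term of $S$ and then all $0$s are removed. $S$ is \emph{doubly fractal} if every positive integer occurs in it, $s_1=1$ and $\wedge_S=\vee_S=S$. For a real $\theta>0$, $S$ is a \emph{signature sequence of $\theta$} if the pairs $(i,j)$ of positive integers can be listed, each exactly once, as $(s_1,a_1),(s_2,a_2),\dots$ with $s_1+a_1\theta\le s_2+a_2\theta\le\cdots$, where different pairs with the same value $i+j\theta$ (they exist only for rational $\theta$) are listed by one rule throughout: always with $i$ increasing, or always with $i$ decreasing. (So an irrational $\theta$ has one signature sequence and a positive rational $\theta$ has two.) \textbf{Construction procedure.} For a finite sequence $L$ let $\ell_L$ be the least positive integer not occurring in $L$. \emph{First type.} Let $n\ge 2$; the numbers $1,\dots,n$ are the \emph{main terms}. A \emph{block} runs from a term $1$ to the next term $n$. Start with the two blocks $$L=(1,2,\dots,n,\;1,n+1,2,n+2,\dots,n-1,2n-1,n).$$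 Then extend $L$ repeatedly as follows. Write $\ell=\ell_L$. Let $B$ be the last block of $L$; let $t$ be the sequence of the terms of $B$ strictly between $n-1$ and $n$, with $1$ added to each; let $t'$ be the sequence of the terms of $L$ strictly between the last term $n+1$ and the last term $n$ before it. Let $i$ be the position of $\ell$ in $t$ and $j$ the position of $1$ in $t'$. Form $P$ from $t'$ with its term $1$ removed: if $i=j$, insert, by free choice, either $(1,\ell)$ or $(\ell,1)$ at position $i$; if $i\ne j$, insert $\ell$ and $1$ simultaneously, at the places given by the positions $i$ and $j$ respectively (so that, for example, $t=(a_1,\ell,a_2,a_3,a_4)$ and $t'=(a_1,a_2,a_3,1,a_4)$ give $P=(a_1,\ell,a_2,a_3,1,a_4)$). Let $d$ be the position of $1$ in $P$ minus the position of $\ell$ in $P$. Append to $L$ the terms of $P$ before its term $1$. Then append $B$, rewritten as follows: for each main term $m=1,\dots,n$ in turn, insert the least positive integer that has not yet appeared, so that its position becomes the position of $m$ minus $d$, provided that this position lies within the new block, between its first term $1$ and its last term $n$; otherwise insert nothing for $m$. The infinite sequence of which all these finite sequences are initial segments is a sequence constructed by the procedure. \emph{Second type.} Let $n\ge2$ and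 let $S'=(s'_1,s'_2,\dots)$ be a sequence of the first type constructed with this $n$. Put $s_1=\dots=s_n=1$, $s_{n+1}=2$ and $s_k=\#\{i : 1\le i\le k,\ s'_i=s'_k\}$ for $k>n+1$. Then $S=(s_1,s_2,\dots)$ is also a sequence constructed by the procedure. \textbf{Theorem.} (a) Every sequence constructed by the procedure (of either type and with any choices) is a signature sequence of some real $\theta>0$. (b) Every doubly fractal sequence is a signature sequence of some real $\theta>0$ (Kimberling's conjecture); and conversely, every signature sequence of a real $\theta>0$ is doubly fractal. Thus the doubly fractal sequences are exactly the signature sequences of positive real numbers. -/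

import Mathlib

namespace Kimberling

/-! An infinite sequence `(s₁, s₂, s₃, …)` of positive integers is a function `S : ℕ → ℕ`
with positive values; the term `s_{k+1}` is `S k`. -/

section Sequences

/-- `T` is what remains of the infinite sequence `S` when exactly the terms whose index lies in
`keep` are kept, in their order. (If `keep` is finite, no infinite `T` remains.) -/
def Remains (S : ℕ → ℕ) (keep : Set ℕ) (T : ℕ → ℕ) : Prop :=
  ∃ φ : ℕ → ℕ, StrictMono φ ∧ Set.range φ = keep ∧ ∀ j, T j = S (φ j)

/-- `T` is the upper trimmed sequence of `S`: the first occurrence of every integer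
is removed, that is, a term is kept if and only if the same value occurs earlier. -/
def IsUpperTrimmed (S T : ℕ → ℕ) : Prop :=
  Remains S {k | ∃ i < k, S i = S k} T

/-- `T` is the lower trimmed sequence of `S`: `1` is subtracted from every
term and then all `0`s are removed. -/
def IsLowerTrimmed (S T : ℕ → ℕ) : Prop :=
  Remains (fun k => S k - 1) {k | S k - 1 ≠ 0} T

/-- Doubly fractal sequences: sequences of positive integers in which every positive integer
occurs, with first term `1`, and equal to both of their trimmed sequences. -/
structure IsDoublyFractal (S : ℕ → ℕ) : Prop where
  pos : ∀ k, 1 ≤ S k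
  occurs : ∀ m, 1 ≤ m → ∃ k, S k = m
  first : S 0 = 1
  upper : IsUpperTrimmed S S
  lower : IsLowerTrimmed S S

/-- `S` is a signature sequence of `θ`: the pairs `(i, j)` of positive integers can be listed,
each exactly once, as `(S 0, a 0), (S 1, a 1), …` such that the numbers `i + j θ` are in
nondecreasing order. If different pairs give the same number (which happens only for rational
`θ`), then they are listed by one rule throughout: always with `i` increasing,
or always with `i` decreasing. -/
def IsSignature (θ : ℝ) (S : ℕ → ℕ) : Prop :=
  ∃ a : ℕ → ℕ,
    Set.BijOn (fun h => (S h, a h)) Set.univ {p : ℕ × ℕ | 1 ≤ p.1 ∧ 1 ≤ p.2} ∧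
    Monotone (fun h => (S h : ℝ) + (a h : ℝ) * θ) ∧
    ((∀ h k, h < k → (S h : ℝ) + (a h : ℝ) * θ = (S k : ℝ) + (a k : ℝ) * θ → S h < S k) ∨
     (∀ h k, h < k → (S h : ℝ) + (a h : ℝ) * θ = (S k : ℝ) + (a k : ℝ) * θ → S k < S h))

end Sequences

section Construction

/-! The construction procedure. Finite sequences are lists; positions in lists count from `0`. -/

theorem exists_missing (L : List ℕ) : ∃ m, 1 ≤ m ∧ m ∉ L := by
  obtain ⟨m, hm⟩ := Infinite.exists_notMem_finset (insert 0 L.toFinset)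
  simp only [Finset.mem_insert, List.mem_toFinset, not_or] at hm
  exact ⟨m, Nat.one_le_iff_ne_zero.mpr hm.1, hm.2⟩

/-- `ℓ_L`: the least positive integer that has not appeared in `L`. -/
def leastMissing (L : List ℕ) : ℕ := Nat.find (exists_missing L)

/-- The terms of `L` after the last occurrence of `x`. -/
def afterLast (x : ℕ) (L : List ℕ) : List ℕ := L.rtakeWhile (fun y => y ≠ x)

/-- The terms of `L` before the last occurrence of `x`. -/
def beforeLast (x : ℕ) (L : List ℕ) : List ℕ := (L.rdropWhile (fun y => y ≠ x)).dropLast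

/-- The last block of `L`: from the last term `1` to the end (`L` will always end in `n`). -/
def lastBlock (L : List ℕ) : List ℕ := 1 :: afterLast 1 L

/-- The sequence `t`: the terms strictly between the main terms `n - 1` and `n` in the last block,
with `1` added to each. -/
def seqT (n : ℕ) (L : List ℕ) : List ℕ :=
  (afterLast (n - 1) (beforeLast n L)).map (· + 1)

/-- The sequence `t'`: the terms strictly between the last term `n + 1` and the last `n` before
it. -/
def seqT' (n : ℕ) (L : List ℕ) : List ℕ :=
  afterLast n (beforeLast (n + 1) L)

/-- The merged sequence `P` of `t` and `t'`, where `ℓ` is the new term of `t`. All terms of `t'`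
but `1` are written down. If `ℓ` has the same position in `t` as `1` has in `t'`, one of
`(1, ℓ)` and `(ℓ, 1)` is inserted at that position (the first one if `c = true`, the second one
if `c = false`). Otherwise `ℓ` and `1` are inserted simultaneously, each in its position; the
insertion further to the right is carried out first, so that it does not disturb the other. -/
def merge (ℓ : ℕ) (t t' : List ℕ) (c : Bool) : List ℕ :=
  let base := t'.erase 1
  let i := t.idxOf ℓ
  let j := t'.idxOf 1
  if i < j then (base.insertIdx j 1).insertIdx i ℓ
  else if j < i then (base.insertIdx i ℓ).insertIdx j 1
  else base.take i ++ (if c then [1, ℓ] else [ℓ, 1]) ++ base.drop i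

/-- In the block `B`, which is written after the sequence `L`, insert the least integer that has
not yet appeared such that afterwards its position is the position of the main term `m`
minus `d`. It is inserted only if this position is within the block, hence strictly between the
positions of the first term (which is `1`) and of the last term (which is `n`) of the block.
If `0 < d`, the insertion moves `m` one place to the right. -/
def insertNear (d : ℤ) (L : List ℕ) (B : List ℕ) (m : ℕ) : List ℕ :=
  let p : ℤ := B.idxOf m
  let q : ℤ := if 0 < d then p + 1 - d else p - d
  if 1 ≤ q ∧ q < B.length then B.insertIdx q.toNat (leastMissing (L ++ B)) else B

/-- Rewriting the block `B` after the sequence `L`: new integers are inserted at distance `d`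
from the main terms `1, 2, …, n`, one after the other. -/
def rewriteBlock (n : ℕ) (d : ℤ) (L B : List ℕ) : List ℕ :=
  ((List.range n).map (· + 1)).foldl (insertNear d L) B

/-- One extension step: append the part of `P` before its term `1`, and then the rewritten last
block. -/
def extend (n : ℕ) (c : Bool) (L : List ℕ) : List ℕ :=
  let ℓ := leastMissing L
  let P := merge ℓ (seqT n L) (seqT' n L) c
  let d : ℤ := (P.idxOf 1 : ℤ) - (P.idxOf ℓ : ℤ)
  let L' := L ++ P.takeWhile (fun y => y ≠ 1)
  L' ++ rewriteBlock n d L' (lastBlock L)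

/-- The first block `1, 2, …, n`. -/
def firstBlock (n : ℕ) : List ℕ := (List.range n).map (· + 1)

/-- The finite sequence after `k` extension steps following the first two blocks. The second block
is `1, n + 1, 2, n + 2, …, n - 1, 2 n - 1, n`: a new integer is inserted directly after each main
term except `n`. The sequence `c` records the choices of `(1, ℓ)` or `(ℓ, 1)`. -/
def stage (n : ℕ) (c : ℕ → Bool) : ℕ → List ℕ
  | 0 => firstBlock n ++
      (List.range (n - 1)).flatMap (fun i => [i + 1, n + (i + 1)]) ++ [n]
  | k + 1 => extend n (c k) (stage n c k)

/-- `S` is constructed from the initial segment `(1, 2, …, n, 1)`, with some choices made: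
every finite stage is an initial segment of `S`. -/
def ConstructedFirst (n : ℕ) (S : ℕ → ℕ) : Prop :=
  ∃ c : ℕ → Bool, ∀ k i, ∀ hi : i < (stage n c k).length, S i = (stage n c k)[i]

/-- `S` is constructed from the initial segment `(1, 1, …, 1, 2)` with `n` ones: a sequence `S'`
is first constructed from `(1, 2, …, n, 1)`, and each later term of `S` is
the number of occurrences of the corresponding term of `S'` so far. -/
def ConstructedSecond (n : ℕ) (S : ℕ → ℕ) : Prop :=
  ∃ S' : ℕ → ℕ, ConstructedFirst n S' ∧
    (∀ k < n, S k = 1) ∧ S n = 2 ∧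
    ∀ k, n < k → S k = ((Finset.range (k + 1)).filter (fun i => S' i = S' k)).card

/-- `S` is produced by the construction procedure, from an initial segment of either type.
The segment `(1, 2)` is the beginning of the first type, so `n ≥ 2` in both cases. -/
def IsConstructed (S : ℕ → ℕ) : Prop :=
  ∃ n, 2 ≤ n ∧ (ConstructedFirst n S ∨ ConstructedSecond n S)

end Construction

end Kimberling

/-! Pair each term of `S` with the number of its occurrences so far. For a doubly fractal `S` this
enumerates all pairs of positive integers: undoing the upper trimming sends `(i, j)` to `(i, j +
1)`, undoing the lower trimming sends it to `(i + 1, j)`, and both preserve the order of the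
sequence. So the enumeration is a translation-invariant total order on the quadrant in which every
element has finitely many predecessors. The differences leading forward are closed under addition
and never vanish; the fractions `p / q` for which `(-p, q)` leads forward form the lower half of a
cut, whose supremum is the slope `θ` (`exists_slope`). Two ties resolved in opposite directions
would have positive multiples with sum zero, hence the single tie rule (`exists_signatureWith`).
Conversely, in a signature sequence the order of two pairs depends only on their difference, and the
trimmings undo the unit translations.

For the procedure it is enough to find the same invariance. By induction, each finite stage is the
list of first components of all pairs up to `(n, r)`, ordered by `i + j θ` for some irrational `θ`
between `n - 1` and `n` (`IsStage`). The gap from `(n, r)` to `(n + 1, r)` contains just one pair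
with first component `1`, namely `(1, r + 1)`, and just one with second component `1`, namely `(ℓ,
1)`. Deleting the former and translating yields `t`; deleting the latter and translating yields
`t'`; so `t` and `t'` determine the order in the gap, unless the two special pairs are neighbours.
In that case the free choice may contradict `θ`, and `θ` is then moved across the slope at which the
two pairs tie, without disturbing anything already listed (`exists_flip`). The block from `(1, r +
1)` to `(n, r + 1)` is the previous block translated by `(0, 1)` together with the new pairs `(ℓ +
s, 1)`; each of these has the same displacement from the main term `(s + 1, r + 1)` as `(ℓ, 1)` has
from `(1, r + 1)`, which explains the fixed distance `d`.

The slope may change from stage to stage, but no limit of slopes is needed: any instance of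
translation invariance involves finitely many indices and is checked within one stage. The final
slope comes from the cut. Sequences of the second type list the second components, which amounts to
replacing `θ` by `1 / θ`. -/

namespace Kimberling

/-! ### Translation-invariant orders on pairs and their slopes -/

section InvariantEnumerations

/-- `w` enumerates the pairs of positive integers, starting with `(1, 1)`, in an order that is
invariant under translations. -/
structure IsInvariantEnum (w : ℕ → ℕ × ℕ) : Prop where
  bij : Set.BijOn w Set.univ {p : ℕ × ℕ | 1 ≤ p.1 ∧ 1 ≤ p.2}
  first : w 0 = (1, 1)
  right : ∀ h k h' k', w h' = w h + (1, 0) → w k' = w k + (1, 0) → h < k → h' < k'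
  up : ∀ h k h' k', w h' = w h + (0, 1) → w k' = w k + (0, 1) → h < k → h' < k'

/-- The vector `(x, y)` leads from some pair to a later pair of the enumeration `w`. -/
def IsForward (w : ℕ → ℕ × ℕ) (x y : ℤ) : Prop :=
  ∃ h k, h < k ∧ ((w k).1 : ℤ) - (w h).1 = x ∧ ((w k).2 : ℤ) - (w h).2 = y

namespace IsInvariantEnum

variable {w : ℕ → ℕ × ℕ}

theorem exists_index (hw : IsInvariantEnum w) {p : ℕ × ℕ} (h1 : 1 ≤ p.1) (h2 : 1 ≤ p.2) :
    ∃ h, w h = p := by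
  obtain ⟨h, -, hh⟩ := hw.bij.surjOn (show p ∈ {p : ℕ × ℕ | 1 ≤ p.1 ∧ 1 ≤ p.2} from ⟨h1, h2⟩)
  exact ⟨h, hh⟩

theorem pos (hw : IsInvariantEnum w) (h : ℕ) : 1 ≤ (w h).1 ∧ 1 ≤ (w h).2 :=
  hw.bij.mapsTo (Set.mem_univ h)

theorem injective (hw : IsInvariantEnum w) : Function.Injective w :=
  fun _ _ h => hw.bij.injOn (Set.mem_univ _) (Set.mem_univ _) h

theorem lt_of_translate_right (hw : IsInvariantEnum w) (a : ℕ) :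
    ∀ h k h' k', w h' = w h + (a, 0) → w k' = w k + (a, 0) → h < k → h' < k' := by
  induction a with
  | zero =>
    intro h k h' k' e1 e2 hlt
    have e1' := hw.injective (e1.trans (by ext <;> simp : w h + (0, 0) = w h))
    have e2' := hw.injective (e2.trans (by ext <;> simp : w k + (0, 0) = w k))
    omega
  | succ a ih =>
    intro h k h' k' e1 e2 hlt
    have p1 := hw.pos h
    have p2 := hw.pos k
    obtain ⟨h1, e3⟩ := hw.exists_index (p := w h + (a, 0)) (by simp; omega) (by simp; omega)
    obtain ⟨k1, e4⟩ := hw.exists_index (p := w k + (a, 0)) (by simp; omega) (by simp; omega)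
    refine hw.right h1 k1 h' k' ?_ ?_ (ih h k h1 k1 e3 e4 hlt)
    · rw [e1, e3]; ext <;> simp [add_assoc]
    · rw [e2, e4]; ext <;> simp [add_assoc]

theorem lt_of_translate (hw : IsInvariantEnum w) (a b : ℕ) :
    ∀ h k h' k', w h' = w h + (a, b) → w k' = w k + (a, b) → h < k → h' < k' := by
  induction b with
  | zero => exact hw.lt_of_translate_right a
  | succ b ih =>
    intro h k h' k' e1 e2 hlt
    have p1 := hw.pos h
    have p2 := hw.pos k
    obtain ⟨h1, e3⟩ := hw.exists_index (p := w h + (a, b)) (by simp; omega) (by simp; omega)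
    obtain ⟨k1, e4⟩ := hw.exists_index (p := w k + (a, b)) (by simp; omega) (by simp; omega)
    refine hw.up h1 k1 h' k' ?_ ?_ (ih h k h1 k1 e3 e4 hlt)
    · rw [e1, e3]; ext <;> simp [add_assoc]
    · rw [e2, e4]; ext <;> simp [add_assoc]

/-- Translating the first step by the start of the second, and the second step by the end of the
first, makes them consecutive. -/
theorem isForward_add (hw : IsInvariantEnum w) {x y x' y' : ℤ} (h1 : IsForward w x y)
    (h2 : IsForward w x' y') : IsForward w (x + x') (y + y') := by
  obtain ⟨h, k, hlt, e1, e2⟩ := h1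
  obtain ⟨h', k', hlt', e1', e2'⟩ := h2
  have p1 := hw.pos h
  have p2 := hw.pos k
  have p3 := hw.pos h'
  have p4 := hw.pos k'
  obtain ⟨a, ha⟩ := hw.exists_index (p := w h + w h') (by simp; omega) (by simp; omega)
  obtain ⟨b, hb⟩ := hw.exists_index (p := w k + w h') (by simp; omega) (by simp; omega)
  obtain ⟨c, hc⟩ := hw.exists_index (p := w k + w k') (by simp; omega) (by simp; omega)
  have l1 : a < b := hw.lt_of_translate _ _ h k a b ha hb hlt
  have l2 : b < c := hw.lt_of_translate (w k).1 (w k).2 h' k' b c (by rw [hb, add_comm])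
    (by rw [hc, add_comm]) hlt'
  refine ⟨a, c, l1.trans l2, ?_, ?_⟩ <;> simp [ha, hc] <;> omega

theorem isForward_nsmul (hw : IsInvariantEnum w) {x y : ℤ} (h1 : IsForward w x y) {n : ℕ}
    (hn : 1 ≤ n) : IsForward w (n * x) (n * y) := by
  induction n, hn using Nat.le_induction with
  | base => simpa using h1
  | succ n _ ih =>
    have := hw.isForward_add ih h1
    push_cast
    rwa [add_mul, add_mul, one_mul, one_mul]

theorem not_isForward_zero (hw : IsInvariantEnum w) : ¬ IsForward w 0 0 := by
  rintro ⟨h, k, hlt, e1, e2⟩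
  have : w h = w k := by ext <;> omega
  have := hw.injective this
  omega

theorem isForward_one_zero (hw : IsInvariantEnum w) : IsForward w 1 0 := by
  obtain ⟨h, hh⟩ := hw.exists_index (p := (2, 1)) (by simp) (by simp)
  refine ⟨0, h, Nat.pos_of_ne_zero ?_, by simp [hh, hw.first], by simp [hh, hw.first]⟩
  rintro rfl
  simp [hw.first] at hh

theorem isForward_zero_one (hw : IsInvariantEnum w) : IsForward w 0 1 := by
  obtain ⟨h, hh⟩ := hw.exists_index (p := (1, 2)) (by simp) (by simp)
  refine ⟨0, h, Nat.pos_of_ne_zero ?_, by simp [hh, hw.first], by simp [hh, hw.first]⟩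
  rintro rfl
  simp [hw.first] at hh

/-- Every pair has only finitely many predecessors. -/
theorem exists_lt_of_injective (hw : IsInvariantEnum w) (g : ℕ → ℕ × ℕ)
    (hg : Function.Injective g) (hpos : ∀ n, 1 ≤ (g n).1 ∧ 1 ≤ (g n).2) (k : ℕ) :
    ∃ n h, w h = g n ∧ k < h := by
  choose f hf using fun n => hw.exists_index (hpos n).1 (hpos n).2
  have hinj : Function.Injective f := fun a b hab => hg (by rw [← hf, ← hf, hab])
  obtain ⟨h, ⟨n, rfl⟩, hlt⟩ := (Set.infinite_range_of_injective hinj).exists_gt k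
  exact ⟨n, f n, hf n, hlt⟩

/-- An Archimedean property: `(1, 2)` has only finitely many predecessors, so some `(n + 2, 1)`
comes after it. This bounds the slope from above; the mirrored statement below makes it positive. -/
theorem exists_isForward_neg_one (hw : IsInvariantEnum w) :
    ∃ N : ℕ, 1 ≤ N ∧ IsForward w N (-1) := by
  obtain ⟨k, hk⟩ := hw.exists_index (p := (1, 2)) (by simp) (by simp)
  obtain ⟨n, h, hh, hlt⟩ := hw.exists_lt_of_injective (fun n => (n + 2, 1))
    (fun a b hab => by simpa using hab) (fun n => by simp) k
  exact ⟨n + 1, by omega, k, h, hlt, by simp [hk, hh]; ring, by simp [hk, hh]⟩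

theorem exists_isForward_neg_one' (hw : IsInvariantEnum w) :
    ∃ N : ℕ, 1 ≤ N ∧ IsForward w (-1) N := by
  obtain ⟨k, hk⟩ := hw.exists_index (p := (2, 1)) (by simp) (by simp)
  obtain ⟨n, h, hh, hlt⟩ := hw.exists_lt_of_injective (fun n => (1, n + 2))
    (fun a b hab => by simpa using hab) (fun n => by simp) k
  exact ⟨n + 1, by omega, k, h, hlt, by simp [hk, hh], by simp [hk, hh]; ring⟩

/-- Otherwise `q'` copies of the first vector and `q` copies of the second add up to a negative
multiple of `(1, 0)`, which copies of `(1, 0)` cancel to the zero vector. Thus every lower fraction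
of the cut is at most every upper one. -/
theorem mul_le_of_isForward (hw : IsInvariantEnum w) {p q p' q' : ℕ} (hq : 1 ≤ q) (hq' : 1 ≤ q')
    (h1 : IsForward w (-p) q) (h2 : IsForward w p' (-q')) : p * q' ≤ p' * q := by
  by_contra hlt
  have e1 := hw.isForward_nsmul h1 hq'
  have e2 := hw.isForward_nsmul h2 hq
  have e3 := hw.isForward_add e1 e2
  have e4 := hw.isForward_nsmul hw.isForward_one_zero (n := p * q' - p' * q) (by omega)
  refine hw.not_isForward_zero ?_
  convert hw.isForward_add e3 e4 using 1
  · push_cast [Nat.cast_sub (not_le.mp hlt).le]; ring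
  · ring

theorem exists_slope (hw : IsInvariantEnum w) : ∃ θ : ℝ, 0 < θ ∧
    ∀ x y : ℤ, IsForward w x y → 0 ≤ (x : ℝ) + y * θ := by
  obtain ⟨N, hN, hN'⟩ := hw.exists_isForward_neg_one
  obtain ⟨M, hM, hM'⟩ := hw.exists_isForward_neg_one'
  -- A forward vector `(-p, q)` forces `p / q ≤ θ`; the slope is taken to be the supremum of these
  -- lower bounds.
  let A : Set ℝ := {x | ∃ p q : ℕ, 1 ≤ q ∧ IsForward w (-p) q ∧ x = p / q}
  have hub : ∀ p' q' : ℕ, 1 ≤ q' → IsForward w p' (-q') → ∀ x ∈ A, x ≤ p' / q' := by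
    rintro p' q' hq' hf x ⟨p, q, hq, hf', rfl⟩
    have := hw.mul_le_of_isForward hq hq' hf' hf
    rw [div_le_div_iff₀ (by positivity) (by positivity)]
    exact_mod_cast this
  have hbdd : BddAbove A := ⟨N / (1 : ℕ), hub N 1 le_rfl (by simpa using hN')⟩
  have hMA : (1 / M : ℝ) ∈ A := ⟨1, M, hM, by simpa using hM', by simp⟩
  refine ⟨sSup A, lt_of_lt_of_le (by positivity) (le_csSup hbdd hMA), ?_⟩
  have hθ : 0 ≤ sSup A := le_trans (by positivity) (le_csSup hbdd hMA)
  intro x y hxy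
  rcases lt_or_ge x 0 with hx | hx
  · obtain ⟨p, rfl⟩ : ∃ p : ℕ, x = -p := ⟨x.natAbs, by omega⟩
    rcases lt_or_ge 0 y with hy | hy
    · obtain ⟨q, rfl⟩ : ∃ q : ℕ, y = q := ⟨y.natAbs, by omega⟩
      have hq : 1 ≤ q := by omega
      have : (p / q : ℝ) ≤ sSup A := le_csSup hbdd ⟨p, q, hq, hxy, rfl⟩
      rw [div_le_iff₀ (by positivity)] at this
      push_cast
      linarith
    · exfalso
      obtain ⟨q, rfl⟩ : ∃ q : ℕ, y = -q := ⟨y.natAbs, by omega⟩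
      -- With both coordinates nonpositive, copies of the two forward unit vectors cancel the
      -- vector.
      have e1 := hw.isForward_add hxy (hw.isForward_nsmul hw.isForward_one_zero (n := p) (by omega))
      rcases Nat.eq_zero_or_pos q with rfl | hq
      · exact hw.not_isForward_zero (by simpa using e1)
      · have e2 := hw.isForward_add e1 (hw.isForward_nsmul hw.isForward_zero_one (n := q) hq)
        exact hw.not_isForward_zero (by simpa using e2)
  · rcases lt_or_ge y 0 with hy | hy
    · obtain ⟨p, rfl⟩ : ∃ p : ℕ, x = p := ⟨x.natAbs, by omega⟩
      obtain ⟨q, rfl⟩ : ∃ q : ℕ, y = -q := ⟨y.natAbs, by omega⟩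
      have hq : 1 ≤ q := by omega
      have : sSup A ≤ (p / q : ℝ) := csSup_le ⟨_, hMA⟩ (hub p q hq hxy)
      rw [le_div_iff₀ (by positivity)] at this
      push_cast
      linarith
    · positivity

end IsInvariantEnum

/-- `S` is a signature sequence of `θ`, and the second components of the listed pairs are `a`. -/
def SignatureWith (θ : ℝ) (S a : ℕ → ℕ) : Prop :=
  Set.BijOn (fun h => (S h, a h)) Set.univ {p : ℕ × ℕ | 1 ≤ p.1 ∧ 1 ≤ p.2} ∧
    Monotone (fun h => (S h : ℝ) + (a h : ℝ) * θ) ∧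
    ((∀ h k, h < k → (S h : ℝ) + (a h : ℝ) * θ = (S k : ℝ) + (a k : ℝ) * θ → S h < S k) ∨
     (∀ h k, h < k → (S h : ℝ) + (a h : ℝ) * θ = (S k : ℝ) + (a k : ℝ) * θ → S k < S h))

/-- The slope gives only weak monotonicity, so ties need a separate argument: tied vectors all lie
on the line `x + y θ = 0`, and two of them pointing in opposite directions combine to the zero
vector. -/
theorem IsInvariantEnum.exists_signatureWith {S a : ℕ → ℕ}
    (hw : IsInvariantEnum fun h => (S h, a h)) : ∃ θ : ℝ, 0 < θ ∧ SignatureWith θ S a := by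
  obtain ⟨θ, hθ, H⟩ := hw.exists_slope
  have hfwd : ∀ h k, h < k → IsForward (fun h => (S h, a h)) ((S k : ℤ) - S h) ((a k : ℤ) - a h) :=
    fun h k hlt => ⟨h, k, hlt, rfl, rfl⟩
  refine ⟨θ, hθ, hw.bij, ?_, ?_⟩
  · refine monotone_nat_of_le_succ fun h => ?_
    have := H _ _ (hfwd h (h + 1) (Nat.lt_succ_self h))
    push_cast at this
    linarith
  · by_contra hcon
    push Not at hcon
    obtain ⟨⟨h, k, hlt, heq, hle⟩, h', k', hlt', heq', hle'⟩ := hcon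
    have ne : ∀ h k, h < k → (S h : ℝ) + (a h : ℝ) * θ = (S k : ℝ) + (a k : ℝ) * θ →
        S h ≠ S k := by
      intro h k hlt heq hS
      rw [hS] at heq
      have : a h = a k := by
        have := mul_right_cancel₀ hθ.ne' (add_left_cancel heq)
        exact_mod_cast this
      have := hw.injective (Prod.ext hS this)
      omega
    have l1 : S k < S h := lt_of_le_of_ne hle (ne h k hlt heq).symm
    have l2 : S h' < S k' := lt_of_le_of_ne hle' (ne h' k' hlt' heq')
    -- The multipliers are chosen to cancel the first components; the second ones then cancel
    -- because `θ ≠ 0`.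
    have e1 := hw.isForward_nsmul (hfwd h k hlt) (n := S k' - S h') (by omega)
    have e2 := hw.isForward_nsmul (hfwd h' k' hlt') (n := S h - S k) (by omega)
    have e3 := hw.isForward_add e1 e2
    refine hw.not_isForward_zero ?_
    convert e3 using 1
    · push_cast [Nat.cast_sub l1.le, Nat.cast_sub l2.le]; ring
    · push_cast [Nat.cast_sub l1.le, Nat.cast_sub l2.le]
      have : (((S k' : ℝ) - S h') * (a k - a h) + (S h - S k) * (a k' - a h')) * θ = 0 := by
        linear_combination ((S k' : ℝ) - S h') * (-heq) + ((S h : ℝ) - S k) * (-heq')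
      have := (mul_eq_zero.mp this).resolve_right hθ.ne'
      exact_mod_cast this.symm

end InvariantEnumerations

/-! ### Doubly fractal sequences and signature sequences -/

section DoublyFractal

/-- The number of occurrences of the term `S h` up to the index `h`. -/
def occ (S : ℕ → ℕ) (h : ℕ) : ℕ := ((Finset.range (h + 1)).filter (fun i => S i = S h)).card

theorem one_le_occ (S : ℕ → ℕ) (h : ℕ) : 1 ≤ occ S h :=
  Finset.card_pos.mpr ⟨h, by simp⟩

theorem occ_lt_occ {S : ℕ → ℕ} {h k : ℕ} (hlt : h < k) (hS : S h = S k) : occ S h < occ S k := by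
  refine Finset.card_lt_card (Finset.ssubset_iff_of_subset ?_ |>.mpr ⟨k, ?_, ?_⟩)
  · intro i hi
    simp only [Finset.mem_filter, Finset.mem_range] at hi ⊢
    exact ⟨by omega, hi.2.trans hS⟩
  · simp
  · simp; omega

theorem occ_injective (S : ℕ → ℕ) : Function.Injective (fun h => (S h, occ S h)) := by
  intro h k hhk
  simp only [Prod.mk.injEq] at hhk
  rcases lt_trichotomy h k with hlt | heq | hlt
  · exact absurd hhk.2 (occ_lt_occ hlt hhk.1).ne
  · exact heq
  · exact absurd hhk.2 (occ_lt_occ hlt hhk.1.symm).ne'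

theorem card_filter_comp_of_strictMono {φ : ℕ → ℕ} (hφ : StrictMono φ) (p q : ℕ → Prop)
    [DecidablePred p] [DecidablePred q] (hq : ∀ k, q k ↔ k ∈ Set.range φ) (j : ℕ) :
    ((Finset.range (j + 1)).filter (fun i => p (φ i))).card =
      ((Finset.range (φ j + 1)).filter (fun k => p k ∧ q k)).card := by
  refine Finset.card_nbij φ ?_ hφ.injective.injOn ?_
  · intro i hi
    simp only [Finset.coe_filter, Finset.mem_range, Set.mem_ofPred_eq] at hi ⊢
    have := hφ.monotone (show i ≤ j by omega)
    exact ⟨by omega, hi.2, (hq _).mpr ⟨i, rfl⟩⟩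
  · rintro k hk
    simp only [Finset.coe_filter, Finset.mem_range, Set.mem_ofPred_eq] at hk
    obtain ⟨h1, h2, h3⟩ := hk
    obtain ⟨i, rfl⟩ := (hq k).mp h3
    have : i ≤ j := hφ.le_iff_le.mp (by omega)
    exact ⟨i, by simpa using ⟨by omega, h2⟩, rfl⟩

/-- Among the occurrences of a value, trimming loses exactly the first, so a kept term has one more
occurrence before trimming than after. -/
theorem occ_of_isUpperTrimmed {S φ : ℕ → ℕ} (hφ : StrictMono φ)
    (hr : Set.range φ = {k | ∃ i < k, S i = S k}) (hS : ∀ j, S j = S (φ j)) (j : ℕ) :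
    occ S (φ j) = occ S j + 1 := by
  have h1 : occ S j = ((Finset.range (j + 1)).filter (fun i => S (φ i) = S (φ j))).card := by
    simp only [occ, ← hS]
  have hex : ∃ i, S i = S (φ j) := ⟨φ j, rfl⟩
  have hmin : Nat.find hex ≤ φ j := Nat.find_min' hex rfl
  rw [h1, card_filter_comp_of_strictMono hφ (fun k => S k = S (φ j)) (fun k => ∃ i < k, S i = S k)
    (fun k => by rw [hr]; rfl), occ]
  rw [← Finset.card_insert_of_notMem (a := Nat.find hex)]
  · congr 1
    ext k
    simp only [Finset.mem_filter, Finset.mem_range, Finset.mem_insert]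
    constructor
    · rintro ⟨h2, h3⟩
      rcases (Nat.find_min' hex h3).lt_or_eq with h4 | h4
      · exact Or.inr ⟨h2, h3, _, h4, (Nat.find_spec hex).trans h3.symm⟩
      · exact Or.inl h4.symm
    · rintro (rfl | h)
      · exact ⟨by omega, Nat.find_spec hex⟩
      · exact ⟨h.1, h.2.1⟩
  · simp only [Finset.mem_filter, not_and, not_exists]
    intro _ _ i hi he
    exact Nat.find_min hex hi (he.trans (Nat.find_spec hex))

/-- All occurrences of a value greater than `1` survive, and equal values stay equal, so the count
does not change. -/
theorem occ_of_isLowerTrimmed {S ψ : ℕ → ℕ} (hψ : StrictMono ψ)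
    (hr : Set.range ψ = {k | S k - 1 ≠ 0}) (hS : ∀ j, S j = S (ψ j) - 1) (j : ℕ) :
    occ S (ψ j) = occ S j := by
  have h2 : ∀ i, S (ψ i) - 1 ≠ 0 := fun i => by
    have : ψ i ∈ Set.range ψ := ⟨i, rfl⟩
    rwa [hr] at this
  have h1 : occ S j = ((Finset.range (j + 1)).filter (fun i => S (ψ i) = S (ψ j))).card := by
    unfold occ
    congr 1
    ext i
    have := h2 i
    have := h2 j
    simp only [Finset.mem_filter, Finset.mem_range, hS i, hS j, and_congr_right_iff]
    omega
  rw [h1, card_filter_comp_of_strictMono hψ (fun k => S k = S (ψ j)) (fun k => S k - 1 ≠ 0)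
    (fun k => by rw [hr]; rfl), occ]
  congr 1
  ext k
  have := h2 j
  simp only [Finset.mem_filter, Finset.mem_range]
  constructor
  · rintro ⟨h3, h4⟩
    exact ⟨h3, h4, by omega⟩
  · rintro ⟨h3, h4, -⟩
    exact ⟨h3, h4⟩

/-- The index maps `φ` and `ψ` of the two trimmings realise the translations by `(0, 1)` and `(1,
0)`; being strictly increasing, they give the invariance. Surjectivity starts at the first
occurrence of `m` and climbs by `φ`. -/
theorem IsDoublyFractal.isInvariantEnum {S : ℕ → ℕ} (hS : IsDoublyFractal S) :
    IsInvariantEnum fun h => (S h, occ S h) := by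
  obtain ⟨φ, hφ, hφr, hφS⟩ := hS.upper
  obtain ⟨ψ, hψ, hψr, hψS⟩ := hS.lower
  have oφ := occ_of_isUpperTrimmed hφ hφr hφS
  have oψ := occ_of_isLowerTrimmed hψ hψr hψS
  have hinj := occ_injective S
  have hψ' : ∀ j, S (ψ j) = S j + 1 := fun j => by
    have h1 : S j = S (ψ j) - 1 := hψS j
    have h2 := hS.pos j
    omega
  refine ⟨⟨fun h _ => ⟨hS.pos h, one_le_occ S h⟩, hinj.injOn, ?_⟩, ?_, ?_, ?_⟩
  · rintro ⟨m, j⟩ ⟨hm, hj⟩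
    simp only at hm hj
    rw [Set.image_univ]
    induction j, hj using Nat.le_induction with
    | base =>
      have hex := hS.occurs m hm
      refine ⟨Nat.find hex, ?_⟩
      have h1 := Nat.find_spec hex
      simp only [Prod.mk.injEq]
      refine ⟨h1, ?_⟩
      rw [occ, Finset.card_eq_one]
      refine ⟨Nat.find hex, ?_⟩
      ext i
      simp only [Finset.mem_filter, Finset.mem_range, Finset.mem_singleton]
      constructor
      · rintro ⟨h2, h3⟩
        have := Nat.find_min' hex (h3.trans h1)
        omega
      · rintro rfl
        simp
    | succ j hj ih =>
      obtain ⟨h, hh⟩ := ih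
      simp only [Prod.mk.injEq] at hh
      exact ⟨φ h, by simp only [oφ, hh.2, ← hφS, hh.1]⟩
  · simp [hS.first, occ, Finset.filter_singleton]
  · intro h k h' k' e1 e2 hlt
    have e1' : h' = ψ h := hinj (e1.trans (by simp [hψ', oψ]))
    have e2' : k' = ψ k := hinj (e2.trans (by simp [hψ', oψ]))
    rw [e1', e2']
    exact hψ hlt
  · intro h k h' k' e1 e2 hlt
    have e1' : h' = φ h := hinj (e1.trans (by simp [← hφS, oφ]))
    have e2' : k' = φ k := hinj (e2.trans (by simp [← hφS, oφ]))
    rw [e1', e2']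
    exact hφ hlt

theorem IsSignature.isDoublyFractal {θ : ℝ} (hθ : 0 < θ) {S : ℕ → ℕ} (hS : IsSignature θ S) :
    IsDoublyFractal S := by
  obtain ⟨a, hbij, hmono, hrule⟩ := hS
  have hpos : ∀ h, 1 ≤ S h ∧ 1 ≤ a h := fun h => hbij.mapsTo (Set.mem_univ h)
  have hinj : ∀ h k, S h = S k → a h = a k → h = k := fun h k h1 h2 =>
    hbij.injOn (Set.mem_univ _) (Set.mem_univ _) (Prod.ext h1 h2)
  have hsurj : ∀ i j, 1 ≤ i → 1 ≤ j → ∃ h, S h = i ∧ a h = j := fun i j hi hj => by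
    obtain ⟨h, -, hh⟩ := hbij.surjOn (show (i, j) ∈ {p : ℕ × ℕ | 1 ≤ p.1 ∧ 1 ≤ p.2} from ⟨hi, hj⟩)
    exact ⟨h, by simpa using hh⟩
  have hval : ∀ h k, (S h : ℝ) + a h * θ < S k + a k * θ → h < k := fun h k hlt => by
    by_contra hcon
    exact absurd (hmono (not_lt.mp hcon)) (not_le.mpr hlt)
  -- The order of two pairs depends only on their difference.
  have hinv : ∀ h k h' k' : ℕ, (S h' : ℝ) - S k' = S h - S k → (a h' : ℝ) - a k' = a h - a k →
      h < k → h' < k' := by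
    intro h k h' k' e1 e2 hlt
    have hle := hmono hlt.le
    simp only at hle
    rcases hle.lt_or_eq with hl | he
    · refine hval _ _ ?_
      have : ((a h' : ℝ) - a k') * θ = (a h - a k) * θ := by rw [e2]
      linarith
    · have he' : (S h' : ℝ) + a h' * θ = S k' + a k' * θ := by
        have : ((a h' : ℝ) - a k') * θ = (a h - a k) * θ := by rw [e2]
        linarith
      rcases lt_trichotomy h' k' with h1 | h1 | h1
      · exact h1
      · exfalso
        subst h1
        have h2 : S h = S k := by
          have : (S h : ℝ) = S k := by linarith
          exact_mod_cast this
        have h3 : a h = a k := by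
          have : (a h : ℝ) = a k := by linarith
          exact_mod_cast this
        exact hlt.ne (hinj _ _ h2 h3)
      · exfalso
        rcases hrule with hr | hr
        · have h2 : (S h : ℝ) < S k := by exact_mod_cast hr h k hlt he
          have h3 : (S k' : ℝ) < S h' := by exact_mod_cast hr k' h' h1 he'.symm
          linarith
        · have h2 : (S k : ℝ) < S h := by exact_mod_cast hr h k hlt he
          have h3 : (S h' : ℝ) < S k' := by exact_mod_cast hr k' h' h1 he'.symm
          linarith
  refine ⟨fun k => (hpos k).1, fun m hm => ?_, ?_, ?_, ?_⟩
  · obtain ⟨h, hh, -⟩ := hsurj m 1 hm le_rfl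
    exact ⟨h, hh⟩
  · obtain ⟨h, h1, h2⟩ := hsurj 1 1 le_rfl le_rfl
    have h3 := hmono (Nat.zero_le h)
    simp only [h1, h2] at h3
    have h4 : (1 : ℝ) ≤ S 0 := by exact_mod_cast (hpos 0).1
    have h5 : (1 : ℝ) ≤ a 0 := by exact_mod_cast (hpos 0).2
    push_cast at h3
    have h6 : (S 0 : ℝ) ≤ 1 := by nlinarith
    exact le_antisymm (by exact_mod_cast h6) (hpos 0).1
  -- The kept terms are those whose pair has second component at least `2`: an equal earlier term is
  -- a pair with the same `i` and smaller `j`.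
  · choose φ hφ1 hφ2 using fun j => hsurj (S j) (a j + 1) (hpos j).1 (by omega)
    refine ⟨φ, fun j k hlt => ?_, ?_, fun j => (hφ1 j).symm⟩
    · refine hinv j k _ _ ?_ ?_ hlt
      · rw [hφ1, hφ1]
      · rw [hφ2, hφ2]; push_cast; ring
    · ext k
      constructor
      · rintro ⟨j, rfl⟩
        refine ⟨j, hval _ _ ?_, (hφ1 j).symm⟩
        rw [hφ1, hφ2]
        push_cast
        linarith
      · rintro ⟨i, hik, hS⟩
        have h1 := hmono hik.le
        simp only [hS] at h1
        have h2 : a i ≤ a k := by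
          have : (a i : ℝ) ≤ a k := le_of_mul_le_mul_right (by linarith) hθ
          exact_mod_cast this
        have h3 : a i ≠ a k := fun h => hik.ne (hinj _ _ hS h)
        have h4 := hpos i
        obtain ⟨j, hj1, hj2⟩ := hsurj (S k) (a k - 1) (hpos k).1 (by omega)
        exact ⟨j, hinj _ _ (by rw [hφ1, hj1]) (by rw [hφ2, hj2]; omega)⟩
  · choose ψ hψ1 hψ2 using fun j => hsurj (S j + 1) (a j) (by omega) (hpos j).2
    refine ⟨ψ, fun j k hlt => ?_, ?_, fun j => by simp [hψ1]⟩
    · refine hinv j k _ _ ?_ ?_ hlt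
      · rw [hψ1, hψ1]; push_cast; ring
      · rw [hψ2, hψ2]
    · ext k
      constructor
      · rintro ⟨j, rfl⟩
        have := (hpos j).1
        simp only [Set.mem_ofPred_eq, hψ1]
        omega
      · intro hk
        simp only [Set.mem_ofPred_eq] at hk
        obtain ⟨j, hj1, hj2⟩ := hsurj (S k - 1) (a k) (by omega) (hpos k).2
        exact ⟨j, hinj _ _ (by rw [hψ1, hj1]; omega) (by rw [hψ2, hj2])⟩

theorem isDoublyFractal_iff (S : ℕ → ℕ) :
    IsDoublyFractal S ↔ ∃ θ : ℝ, 0 < θ ∧ IsSignature θ S := by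
  constructor
  · intro hS
    obtain ⟨θ, hθ, h⟩ := hS.isInvariantEnum.exists_signatureWith
    exact ⟨θ, hθ, occ S, h⟩
  · rintro ⟨θ, hθ, h⟩
    exact h.isDoublyFractal hθ

/-- The second components of a signature sequence of `θ` form a signature sequence of `1 / θ`. -/
theorem SignatureWith.swap {θ : ℝ} (hθ : 0 < θ) {S a : ℕ → ℕ} (h : SignatureWith θ S a) :
    SignatureWith (1 / θ) a S := by
  obtain ⟨hbij, hmono, hrule⟩ := h
  have key : ∀ h, (a h : ℝ) + S h * (1 / θ) = (S h + a h * θ) / θ := fun h => by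
    field_simp
    ring
  refine ⟨?_, ?_, ?_⟩
  · refine ⟨fun h _ => (hbij.mapsTo (Set.mem_univ h)).symm, fun h _ k _ hhk => ?_, ?_⟩
    · simp only [Prod.mk.injEq] at hhk
      exact hbij.injOn (Set.mem_univ _) (Set.mem_univ _) (Prod.ext hhk.2 hhk.1)
    · rintro ⟨i, j⟩ ⟨hi, hj⟩
      obtain ⟨h, -, hh⟩ :=
        hbij.surjOn (show (j, i) ∈ {p : ℕ × ℕ | 1 ≤ p.1 ∧ 1 ≤ p.2} from ⟨hj, hi⟩)
      simp only [Prod.mk.injEq] at hh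
      exact ⟨h, Set.mem_univ _, Prod.ext hh.2 hh.1⟩
  · intro h k hhk
    simp only [key]
    exact div_le_div_of_nonneg_right (hmono hhk) hθ.le
  · have conv : ∀ h k, (a h : ℝ) + S h * (1 / θ) = a k + S k * (1 / θ) →
        (S h : ℝ) + a h * θ = S k + a k * θ := fun h k e => by
      rw [key, key] at e
      exact (div_left_inj' hθ.ne').mp e
    refine hrule.symm.imp (fun H h k hlt e => ?_) (fun H h k hlt e => ?_)
    · have e' := conv h k e
      have : (S k : ℝ) < S h := by exact_mod_cast H h k hlt e'
      have : (a h : ℝ) < a k := lt_of_mul_lt_mul_right (by linarith) hθ.le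
      exact_mod_cast this
    · have e' := conv h k e
      have : (S h : ℝ) < S k := by exact_mod_cast H h k hlt e'
      have : (a k : ℝ) < a h := lt_of_mul_lt_mul_right (by linarith) hθ.le
      exact_mod_cast this

end DoublyFractal

end Kimberling

namespace Kimberling

/-! ### List operations of the procedure -/

section ListOperations

theorem afterLast_append_cons {x : ℕ} (A : List ℕ) {B : List ℕ} (hB : x ∉ B) :
    afterLast x (A ++ x :: B) = B := by
  induction B using List.reverseRecOn with
  | nil => simp [afterLast]
  | append_singleton B b ih =>
    simp only [List.mem_append, List.mem_singleton, not_or] at hB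
    have := ih hB.1
    rw [afterLast] at this ⊢
    rw [← List.cons_append, ← List.append_assoc, List.rtakeWhile_concat_pos, this]
    simpa using Ne.symm hB.2

theorem beforeLast_append_cons {x : ℕ} (A : List ℕ) {B : List ℕ} (hB : x ∉ B) :
    beforeLast x (A ++ x :: B) = A := by
  induction B using List.reverseRecOn with
  | nil => simp [beforeLast]
  | append_singleton B b ih =>
    simp only [List.mem_append, List.mem_singleton, not_or] at hB
    have := ih hB.1
    rw [beforeLast] at this ⊢
    rw [← List.cons_append, ← List.append_assoc, List.rdropWhile_concat_pos, this]
    simpa using Ne.symm hB.2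

theorem idxOf_append_cons {x : ℕ} {A : List ℕ} (B : List ℕ) (hA : x ∉ A) :
    (A ++ x :: B).idxOf x = A.length := by
  rw [List.idxOf_append_of_notMem hA]
  simp

theorem insertIdx_append_length (A B : List ℕ) (x : ℕ) :
    (A ++ B).insertIdx A.length x = A ++ x :: B := by
  induction A with
  | nil => simp
  | cons a A ih => simp [ih]

theorem insertIdx_append_length' {i : ℕ} (A B : List ℕ) (x : ℕ) (hi : i = A.length) :
    (A ++ B).insertIdx i x = A ++ x :: B := by
  rw [hi, insertIdx_append_length]

theorem leastMissing_eq {L : List ℕ} {m : ℕ} (h1 : 1 ≤ m) (hm : m ∉ L)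
    (hlt : ∀ i, 1 ≤ i → i < m → i ∈ L) : leastMissing L = m := by
  rw [leastMissing, Nat.find_eq_iff]
  exact ⟨⟨h1, hm⟩, fun i hi h => h.2 (hlt i h.1 hi)⟩

theorem leastMissing_spec (L : List ℕ) : 1 ≤ leastMissing L ∧ leastMissing L ∉ L :=
  Nat.find_spec (exists_missing L)

theorem mem_of_lt_leastMissing {L : List ℕ} {m : ℕ} (h1 : 1 ≤ m) (h : m < leastMissing L) :
    m ∈ L := by
  by_contra hm
  exact Nat.find_min (exists_missing L) h ⟨h1, hm⟩

theorem erase_append_cons_one {A B : List ℕ} (hA : 1 ∉ A) : (A ++ 1 :: B).erase 1 = A ++ B := by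
  rw [List.erase_append_right _ hA]
  simp

/-- For a true order `A, ℓ, C, 1, D`, deleting `1` or deleting `ℓ` gives these two arguments. The
positions of `ℓ` and `1` coincide exactly when `C` is empty, so merging recovers the order except
for the free choice between neighbours. `merge_of_gt` treats the opposite order. -/
theorem merge_of_lt {ℓ : ℕ} {A C D : List ℕ} (c : Bool) (hA : ℓ ∉ A)
    (hA1 : 1 ∉ A) (hC1 : 1 ∉ C) :
    merge ℓ (A ++ ℓ :: (C ++ D)) (A ++ C ++ 1 :: D) c =
      if C = [] then A ++ (if c then [1, ℓ] else [ℓ, 1]) ++ D else A ++ ℓ :: (C ++ 1 :: D) := by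
  have hAC : 1 ∉ A ++ C := by simp [hA1, hC1]
  simp only [merge, idxOf_append_cons _ hA, idxOf_append_cons _ hAC, erase_append_cons_one hAC]
  by_cases hC : C = []
  · subst hC
    simp
  · have : 0 < C.length := List.length_pos_iff.mpr hC
    rw [if_pos (by simp; omega), if_neg hC, insertIdx_append_length, List.append_assoc,
      insertIdx_append_length]

theorem merge_of_gt {ℓ : ℕ} {A C D : List ℕ} (c : Bool) (hA : ℓ ∉ A) (hC : ℓ ∉ C)
    (hA1 : 1 ∉ A) :
    merge ℓ (A ++ C ++ ℓ :: D) (A ++ 1 :: (C ++ D)) c =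
      if C = [] then A ++ (if c then [1, ℓ] else [ℓ, 1]) ++ D else A ++ 1 :: (C ++ ℓ :: D) := by
  have hAC : ℓ ∉ A ++ C := by simp [hA, hC]
  simp only [merge, idxOf_append_cons _ hA1, idxOf_append_cons _ hAC, erase_append_cons_one hA1]
  by_cases hC : C = []
  · subst hC
    simp
  · have : 0 < C.length := List.length_pos_iff.mpr hC
    rw [if_neg (by simp), if_pos (by simp; omega), if_neg hC, ← List.append_assoc,
      insertIdx_append_length, List.append_assoc, insertIdx_append_length]

end ListOperations

/-! ### Sorted lists of pairs -/

section Listings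

/-- The number `i + j θ` of the pair `(i, j)`. -/
def val (θ : ℝ) (p : ℕ × ℕ) : ℝ := p.1 + p.2 * θ

@[simp] theorem val_mk (θ : ℝ) (i j : ℕ) : val θ (i, j) = i + j * θ := rfl

theorem val_add (θ : ℝ) (p q : ℕ × ℕ) : val θ (p + q) = val θ p + val θ q := by
  simp [val]; ring

theorem val_injective {θ : ℝ} (hθ : Irrational θ) : Function.Injective (val θ) := by
  rintro ⟨i, j⟩ ⟨i', j'⟩ h
  simp only [val_mk] at h
  by_cases hj : j = j'
  · subst hj
    simpa using h
  · exfalso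
    have hj' : (j : ℝ) - j' ≠ 0 := sub_ne_zero.mpr (by exact_mod_cast hj)
    apply hθ
    refine ⟨((i' : ℚ) - i) / (j - j'), ?_⟩
    push_cast
    rw [div_eq_iff hj']
    linarith

/-- The list `l` consists of the pairs in `C`, in the order of their numbers `i + j θ`. -/
structure Lists (θ : ℝ) (C : Set (ℕ × ℕ)) (l : List (ℕ × ℕ)) : Prop where
  sorted : l.Pairwise fun p q => val θ p < val θ q
  mem : ∀ p, p ∈ l ↔ p ∈ C

namespace Lists

variable {θ : ℝ} {C D : Set (ℕ × ℕ)} {l l' A B : List (ℕ × ℕ)}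

theorem congr (h : Lists θ C l) (hCD : ∀ p, p ∈ C ↔ p ∈ D) : Lists θ D l :=
  ⟨h.sorted, fun p => (h.mem p).trans (hCD p)⟩

theorem nodup (h : Lists θ C l) : l.Nodup :=
  h.sorted.imp fun hlt heq => by rw [heq] at hlt; exact lt_irrefl _ hlt

/-- Uniqueness of sorted listings turns identities between lists into identities between sets of
pairs. -/
theorem eq (h : Lists θ C l) (h' : Lists θ C l') : l = l' := by
  have hp : l.Perm l' := (List.perm_ext_iff_of_nodup h.nodup h'.nodup).mpr fun p =>
    (h.mem p).trans (h'.mem p).symm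
  exact hp.eq_of_pairwise (fun a b _ _ h1 h2 => absurd h1 h2.not_gt) h.sorted h'.sorted

theorem append (h : Lists θ C l) (h' : Lists θ D l')
    (hlt : ∀ p ∈ C, ∀ q ∈ D, val θ p < val θ q) : Lists θ (C ∪ D) (l ++ l') := by
  refine ⟨List.pairwise_append.mpr ⟨h.sorted, h'.sorted, fun p hp q hq => ?_⟩, fun p => ?_⟩
  · exact hlt p ((h.mem p).mp hp) q ((h'.mem q).mp hq)
  · rw [List.mem_append, h.mem, h'.mem, Set.mem_union]

theorem filter (h : Lists θ C l) (P : ℕ × ℕ → Prop) [DecidablePred P] :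
    Lists θ {p | p ∈ C ∧ P p} (l.filter P) :=
  ⟨h.sorted.filter _, fun p => by simp [h.mem]⟩

theorem singleton (θ : ℝ) (x : ℕ × ℕ) : Lists θ {x} [x] := ⟨by simp, by simp⟩

/-- A listing splits at every one of its members. -/
theorem split (h : Lists θ C l) {x : ℕ × ℕ} (hx : x ∈ C) : ∃ A B, l = A ++ x :: B ∧
    Lists θ {p | p ∈ C ∧ val θ p < val θ x} A ∧ Lists θ {p | p ∈ C ∧ val θ x < val θ p} B := by
  obtain ⟨A, B, rfl⟩ := List.append_of_mem ((h.mem x).mpr hx)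
  have hs := h.sorted
  simp only [List.pairwise_append, List.pairwise_cons, List.mem_cons] at hs
  obtain ⟨h1, ⟨h2, h3⟩, h4⟩ := hs
  refine ⟨A, B, rfl, ⟨h1, fun p => ⟨fun hp => ?_, fun hp => ?_⟩⟩,
    ⟨h3, fun p => ⟨fun hp => ?_, fun hp => ?_⟩⟩⟩
  · exact ⟨(h.mem p).mp (by simp [hp]), h4 p hp x (Or.inl rfl)⟩
  · have := (h.mem p).mpr hp.1
    simp only [List.mem_append, List.mem_cons] at this
    rcases this with h5 | rfl | h5
    · exact h5
    · exact absurd hp.2 (lt_irrefl _)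
    · exact absurd hp.2 (h2 p h5).not_gt
  · exact ⟨(h.mem p).mp (by simp [hp]), h2 p hp⟩
  · have := (h.mem p).mpr hp.1
    simp only [List.mem_append, List.mem_cons] at this
    rcases this with h5 | rfl | h5
    · exact absurd hp.2 (h4 p h5 x (Or.inl rfl)).not_gt
    · exact absurd hp.2 (lt_irrefl _)
    · exact h5

/-- A listing splits at every threshold that is not attained. -/
theorem split_threshold (h : Lists θ C l) (y : ℝ) (hy : ∀ p ∈ C, val θ p ≠ y) :
    ∃ A B, l = A ++ B ∧ Lists θ {p | p ∈ C ∧ val θ p < y} A ∧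
      Lists θ {p | p ∈ C ∧ y < val θ p} B := by
  classical
  refine ⟨_, _, ?_, h.filter (fun p => val θ p < y), h.filter (fun p => y < val θ p)⟩
  refine h.eq (((h.filter (fun p => val θ p < y)).append (h.filter (fun p => y < val θ p))
    fun p hp q hq => hp.2.trans hq.2).congr fun p => ?_)
  constructor
  · rintro (hp | hp)
    exacts [hp.1, hp.1]
  · intro hp
    rcases (hy p hp).lt_or_gt with h1 | h1
    exacts [Or.inl ⟨hp, h1⟩, Or.inr ⟨hp, h1⟩]

theorem map_add (h : Lists θ C l) (u : ℕ × ℕ) :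
    Lists θ {p | ∃ q ∈ C, p = q + u} (l.map (· + u)) := by
  refine ⟨List.pairwise_map.mpr (h.sorted.imp fun hlt => ?_), fun p => ?_⟩
  · simpa [val_add] using hlt
  · simp [h.mem, eq_comm]

theorem remove {x : ℕ × ℕ} (h : Lists θ C (A ++ x :: B)) :
    Lists θ {p | p ∈ C ∧ p ≠ x} (A ++ B) := by
  have hn := h.nodup
  refine ⟨h.sorted.sublist (by simp), fun p => ?_⟩
  have h1 := h.mem p
  simp only [List.mem_append, List.mem_cons] at h1
  simp only [List.nodup_append, List.nodup_cons, List.mem_cons] at hn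
  obtain ⟨-, ⟨h2, -⟩, h3⟩ := hn
  simp only [List.mem_append, Set.mem_ofPred_eq, ← h1]
  constructor
  · rintro (hp | hp)
    · exact ⟨Or.inl hp, h3 p hp x (Or.inl rfl)⟩
    · exact ⟨Or.inr (Or.inr hp), fun he => h2 (he ▸ hp)⟩
  · rintro ⟨hp | rfl | hp, hne⟩
    exacts [Or.inl hp, absurd rfl hne, Or.inr hp]

theorem fst_notMem (h : Lists θ C l) {i : ℕ} (hi : ∀ j, (i, j) ∉ C) : i ∉ l.map Prod.fst := by
  simp only [List.mem_map, not_exists, not_and]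
  rintro ⟨a, b⟩ hp rfl
  exact hi b ((h.mem _).mp hp)

end Lists

/-- The pairs of positive integers whose number `i + j θ` lies in `X`. -/
def seg (θ : ℝ) (X : Set ℝ) : Set (ℕ × ℕ) := {p | 1 ≤ p.1 ∧ 1 ≤ p.2 ∧ val θ p ∈ X}

theorem exists_lists {θ : ℝ} (hθ : Irrational θ) (h0 : 0 < θ) (y : ℝ) {C : Set (ℕ × ℕ)}
    (hC : C ⊆ seg θ (Set.Iic y)) : ∃ l, Lists θ C l := by
  classical
  have hfin : C.Finite := by
    refine ((Set.finite_Iic ⌊y⌋₊).prod (Set.finite_Iic ⌊y / θ⌋₊)).subset fun p hp => ?_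
    obtain ⟨h1, h2, h3⟩ := hC hp
    simp only [val, Set.mem_Iic] at h3
    have h4 : (0 : ℝ) ≤ p.1 := by positivity
    have h5 : (0 : ℝ) ≤ p.2 * θ := by positivity
    refine ⟨Nat.le_floor (by linarith), Nat.le_floor ?_⟩
    rw [le_div_iff₀ h0]
    linarith
  let r : ℕ × ℕ → ℕ × ℕ → Prop := fun p q => val θ p ≤ val θ q
  have : IsTrans (ℕ × ℕ) r := ⟨fun _ _ _ => le_trans⟩
  have : Std.Antisymm r := ⟨fun _ _ h1 h2 => val_injective hθ (le_antisymm h1 h2)⟩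
  have : Std.Total r := ⟨fun _ _ => le_total _ _⟩
  refine ⟨hfin.toFinset.sort r, ?_, fun p => by simp⟩
  have h1 := Finset.pairwise_sort hfin.toFinset r
  have h2 := Finset.sort_nodup hfin.toFinset r
  exact (h1.and h2).imp fun h => lt_of_le_of_ne h.1 fun he => h.2 (val_injective hθ he)

end Listings

end Kimberling

namespace Kimberling

/-! ### Moving the slope across one fraction -/

section Perturbation

/-- If the pairs `(ℓ, 1)` and `(1, r + 1)` are neighbours in the order of the numbers `i + j θ`,
then `θ` can be changed so that they are interchanged, while two pairs keep their order if the
difference of their second components is less than `r`. -/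
theorem exists_flip {θ : ℝ} (hθ : Irrational θ) (h0 : 0 < θ) {r ℓ : ℕ} (hr : 1 ≤ r) (hℓ : 2 ≤ ℓ)
    (hadj : ∀ p : ℕ × ℕ, 1 ≤ p.1 → 1 ≤ p.2 →
      ¬ (val θ (ℓ, 1) < val θ p ∧ val θ p < val θ (1, r + 1)) ∧
      ¬ (val θ (1, r + 1) < val θ p ∧ val θ p < val θ (ℓ, 1))) :
    ∃ θ', Irrational θ' ∧
      (∀ p q : ℕ × ℕ, p.2 < q.2 + r → q.2 < p.2 + r →
        (val θ p < val θ q ↔ val θ' p < val θ' q)) ∧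
      (val θ (ℓ, 1) < val θ (1, r + 1) ↔ val θ' (1, r + 1) < val θ' (ℓ, 1)) := by
  have hr0 : (0 : ℝ) < r := by exact_mod_cast hr
  -- `F = (ℓ - 1) / r` is the slope at which `(ℓ, 1)` and `(1, r + 1)` tie.
  obtain ⟨F, hF⟩ : ∃ F : ℝ, F * r = ℓ - 1 := ⟨(ℓ - 1) / r, by field_simp⟩
  have hℓ' : (2 : ℝ) ≤ ℓ := by exact_mod_cast hℓ
  have hF0 : 0 < F := by
    by_contra h
    nlinarith
  have hne : θ ≠ F := by
    rintro rfl
    have h1 : val θ (ℓ, 1) = val θ (1, r + 1) := by simp; linarith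
    have h2 := val_injective hθ h1
    simp only [Prod.mk.injEq] at h2
    omega
  -- A fraction of denominator `b < r` other than `F` is at distance at least `1 / (b r) > 1 / r² =
  -- δ` from `F`.
  obtain ⟨δ, hδ⟩ : ∃ δ : ℝ, δ * r * r = 1 := ⟨1 / (r * r), by field_simp⟩
  have hδ0 : 0 < δ := by
    by_contra h
    have : δ * r * r ≤ 0 := by
      have : δ * (r * r) ≤ 0 := mul_nonpos_of_nonpos_of_nonneg (not_lt.mp h) (by positivity)
      linarith
    linarith
  -- It suffices to compare both slopes with the fractions of denominator less than `r`.
  suffices H : ∃ θ', Irrational θ' ∧ (∀ (a : ℤ) (b : ℕ), 1 ≤ b → b < r →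
      ((a : ℝ) < b * θ ↔ (a : ℝ) < b * θ')) ∧ (F < θ ↔ θ' < F) by
    obtain ⟨θ', hirr, hkey, hflip⟩ := H
    refine ⟨θ', hirr, fun p q h1 h2 => ?_, ?_⟩
    · rcases lt_trichotomy p.2 q.2 with h | h | h
      · have := hkey (p.1 - q.1) (q.2 - p.2) (by omega) (by omega)
        push_cast [Nat.cast_sub h.le] at this
        simp only [val]
        constructor
        · intro h3
          have := this.mp (by linarith)
          linarith
        · intro h3
          have := this.mpr (by linarith)
          linarith
      · simp only [val, h]
        constructor <;> intro h3 <;> linarith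
      · have := hkey (q.1 - p.1) (p.2 - q.2) (by omega) (by omega)
        push_cast [Nat.cast_sub h.le] at this
        have hpq : p ≠ q := fun he => by rw [he] at h; exact lt_irrefl _ h
        have e1 : val θ p < val θ q ↔ ¬ val θ q < val θ p :=
          ⟨fun h => h.not_gt, fun h => (not_lt.mp h).lt_of_ne ((val_injective hθ).ne hpq)⟩
        have e2 : val θ' p < val θ' q ↔ ¬ val θ' q < val θ' p :=
          ⟨fun h => h.not_gt, fun h => (not_lt.mp h).lt_of_ne ((val_injective hirr).ne hpq)⟩
        rw [e1, e2, not_iff_not]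
        simp only [val]
        constructor
        · intro h3
          have := this.mp (by linarith)
          linarith
        · intro h3
          have := this.mpr (by linarith)
          linarith
    · have e1 : val θ (ℓ, 1) < val θ (1, r + 1) ↔ F < θ := by
        simp only [val_mk]
        push_cast
        constructor
        · intro h
          by_contra hc
          nlinarith [mul_le_mul_of_nonneg_right (not_lt.mp hc) hr0.le]
        · intro h
          nlinarith [mul_lt_mul_of_pos_right h hr0]
      have e2 : val θ' (1, r + 1) < val θ' (ℓ, 1) ↔ θ' < F := by
        simp only [val_mk]
        push_cast
        constructor
        · intro h
          by_contra hc
          nlinarith [mul_le_mul_of_nonneg_right (not_lt.mp hc) hr0.le]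
        · intro h
          nlinarith [mul_lt_mul_of_pos_right h hr0]
      rw [e1, e2, hflip]
  rcases hne.lt_or_gt with hlt | hlt
  · obtain ⟨θ', hirr, h1, h2⟩ := exists_irrational_btwn (show F < F + δ by linarith)
    refine ⟨θ', hirr, fun a b hb hbr => ⟨fun h => ?_, fun h => ?_⟩, by
      constructor <;> intro h <;> linarith⟩
    · have hb' : (1 : ℝ) ≤ b := by exact_mod_cast hb
      nlinarith
    · have hb' : (1 : ℝ) ≤ b := by exact_mod_cast hb
      have hbr' : (b : ℝ) + 1 ≤ r := by exact_mod_cast hbr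
      by_contra hc
      have hc' : (b : ℝ) * θ < a := by
        refine (not_lt.mp hc).lt_of_ne fun he => hθ ⟨(a : ℚ) / b, ?_⟩
        push_cast
        rw [div_eq_iff (by positivity)]
        linarith
      have ha : (0 : ℤ) < a := by
        have : (0 : ℝ) < b * θ := by positivity
        exact_mod_cast this.trans hc'
      obtain ⟨a, rfl⟩ : ∃ m : ℕ, a = m := ⟨a.natAbs, by omega⟩
      push_cast at hc' h
      rcases le_or_gt (a : ℝ) (b * F) with h3 | h3
      -- A fraction `a / b` between `θ` and `F` would put this pair strictly between the two
      -- neighbours.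
      · refine (hadj (1 + a, r + 1 - b) (by simp) (by simp; omega)).2 ⟨?_, ?_⟩
        · simp only [val_mk]
          push_cast [Nat.cast_sub (show b ≤ r + 1 by omega)]
          linarith
        · simp only [val_mk]
          push_cast [Nat.cast_sub (show b ≤ r + 1 by omega)]
          nlinarith
      -- Beyond `F`, the fraction would be closer to `F` than `δ`; integrality of `a r - b (ℓ - 1)`
      -- forbids this.
      · have h4 : (b : ℝ) * (ℓ - 1) < a * r := by nlinarith
        have h5 : (b : ℤ) * (ℓ - 1) < a * r := by exact_mod_cast h4
        have h6 : (b : ℝ) * (ℓ - 1) + 1 ≤ a * r := by exact_mod_cast h5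
        have h7 : (a : ℝ) < b * F + b * δ := by nlinarith
        have h8 : (a : ℝ) * r < b * (F * r) + b * (δ * r) := by nlinarith
        have h9 : (b : ℝ) * (δ * r) ≤ r * (δ * r) := by
          refine mul_le_mul_of_nonneg_right (by linarith) (by positivity)
        rw [hF] at h8
        linarith
  · obtain ⟨θ', hirr, h1, h2⟩ := exists_irrational_btwn (show F - δ < F by linarith)
    refine ⟨θ', hirr, fun a b hb hbr => ⟨fun h => ?_, fun h => ?_⟩, by
      constructor <;> intro h <;> linarith⟩
    swap
    · have hb' : (1 : ℝ) ≤ b := by exact_mod_cast hb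
      nlinarith
    · have hb' : (1 : ℝ) ≤ b := by exact_mod_cast hb
      have hbr' : (b : ℝ) + 1 ≤ r := by exact_mod_cast hbr
      by_contra hc
      have hc' := not_lt.mp hc
      rcases le_or_gt (b * F) (a : ℝ) with h3 | h3
      · have ha : (0 : ℤ) < a := by
          have : (0 : ℝ) < b * F := by positivity
          exact_mod_cast this.trans_le h3
        obtain ⟨a, rfl⟩ : ∃ m : ℕ, a = m := ⟨a.natAbs, by omega⟩
        push_cast at h h3
        refine (hadj (1 + a, r + 1 - b) (by simp) (by simp; omega)).1 ⟨?_, ?_⟩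
        · simp only [val_mk]
          push_cast [Nat.cast_sub (show b ≤ r + 1 by omega)]
          nlinarith
        · simp only [val_mk]
          push_cast [Nat.cast_sub (show b ≤ r + 1 by omega)]
          linarith
      · have h4 : (a : ℝ) * r < b * (ℓ - 1) := by nlinarith
        have h5 : a * r < (b : ℤ) * (ℓ - 1) := by exact_mod_cast h4
        have h6 : (a : ℝ) * r + 1 ≤ (b : ℝ) * (ℓ - 1) := by exact_mod_cast h5
        have h7 : b * F - b * δ < (a : ℝ) := by nlinarith
        have h8 : b * (F * r) - b * (δ * r) < (a : ℝ) * r := by nlinarith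
        have h9 : (b : ℝ) * (δ * r) ≤ r * (δ * r) := by
          refine mul_le_mul_of_nonneg_right (by linarith) (by positivity)
        rw [hF] at h8
        linarith

end Perturbation

/-! ### Stages, gaps and the merged sequence -/

section Stages

/-- `l` lists the pairs up to `(n, r)` in the order of `i + j θ`, where `n - 1 < θ < n`. -/
structure IsStage (n r : ℕ) (θ : ℝ) (l : List (ℕ × ℕ)) : Prop where
  two_le : 2 ≤ n
  two_le' : 2 ≤ r
  irr : Irrational θ
  lo : (n : ℝ) - 1 < θ
  hi : θ < n
  lists : Lists θ (seg θ (Set.Iic (val θ (n, r)))) l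

/-- The pairs strictly between `(n, r)` and `(n + 1, r)`. -/
def gap (n r : ℕ) (θ : ℝ) : Set (ℕ × ℕ) := seg θ (Set.Ioo (val θ (n, r)) (val θ (n + 1, r)))

theorem mem_gap {n r : ℕ} {θ : ℝ} {p : ℕ × ℕ} : p ∈ gap n r θ ↔ 1 ≤ p.1 ∧ 1 ≤ p.2 ∧
    (n : ℝ) + r * θ < p.1 + p.2 * θ ∧ (p.1 : ℝ) + p.2 * θ < n + 1 + r * θ := by
  simp [gap, seg, val]

theorem natCast_mul_le {θ : ℝ} (h0 : 0 < θ) {a b : ℕ} (h : a ≤ b) : (a : ℝ) * θ ≤ b * θ :=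
  mul_le_mul_of_nonneg_right (by exact_mod_cast h) h0.le

namespace IsStage

variable {n r : ℕ} {θ : ℝ} {l u : List (ℕ × ℕ)}

theorem two_le_cast (h : IsStage n r θ l) : (2 : ℝ) ≤ n := by exact_mod_cast h.two_le

theorem one_lt (h : IsStage n r θ l) : 1 < θ := by linarith [h.two_le_cast, h.lo]

theorem pos (h : IsStage n r θ l) : 0 < θ := by linarith [h.one_lt]

theorem mul_le (h : IsStage n r θ l) {a b : ℕ} (hab : a ≤ b) : (a : ℝ) * θ ≤ b * θ :=
  natCast_mul_le h.pos hab

theorem mem (h : IsStage n r θ l) {p : ℕ × ℕ} :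
    p ∈ l ↔ 1 ≤ p.1 ∧ 1 ≤ p.2 ∧ (p.1 : ℝ) + p.2 * θ ≤ n + r * θ := by
  rw [h.lists.mem]
  simp [seg, val]

theorem mem_map_fst (h : IsStage n r θ l) {i : ℕ} :
    i ∈ l.map Prod.fst ↔ 1 ≤ i ∧ (i : ℝ) + θ ≤ n + r * θ := by
  simp only [List.mem_map, Prod.exists, exists_and_right, exists_eq_right, h.mem]
  constructor
  · rintro ⟨j, h1, h2, h3⟩
    have := h.mul_le h2
    push_cast at this
    exact ⟨h1, by linarith⟩
  · rintro ⟨h1, h2⟩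
    exact ⟨1, h1, le_rfl, by simpa using h2⟩

/-- The integer `ℓ - 1` has appeared and `ℓ` has not, which places `(ℓ, 1)` within distance `1`
after `(n, r)`. Equality at the upper end is excluded by irrationality, as `r ≠ 1`. -/
theorem leastMissing_bounds (h : IsStage n r θ l) : 2 ≤ leastMissing (l.map Prod.fst) ∧
    (n : ℝ) + r * θ < leastMissing (l.map Prod.fst) + θ ∧
    (leastMissing (l.map Prod.fst) : ℝ) + θ < n + 1 + r * θ := by
  obtain ⟨h1, h2⟩ := leastMissing_spec (l.map Prod.fst)
  have h3 : ∀ m, 1 ≤ m → m < leastMissing (l.map Prod.fst) → m ∈ l.map Prod.fst :=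
    fun m => mem_of_lt_leastMissing
  generalize leastMissing (l.map Prod.fst) = ℓ at *
  have hn := h.two_le_cast
  have hr := h.mul_le h.two_le'
  have hθ := h.one_lt
  push_cast at hr
  have h4 : (n : ℝ) + r * θ < ℓ + θ := by
    by_contra hc
    exact h2 (h.mem_map_fst.mpr ⟨h1, not_lt.mp hc⟩)
  have h5 : 2 ≤ ℓ := by
    by_contra hc
    have : ℓ = 1 := by omega
    subst this
    push_cast at h4
    linarith
  have h6 := (h.mem_map_fst.mp (h3 (ℓ - 1) (by omega) (by omega))).2
  push_cast [Nat.cast_sub h1] at h6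
  refine ⟨h5, h4, lt_of_le_of_ne (by linarith) fun he => ?_⟩
  have h7 : val θ (ℓ, 1) = val θ (n + 1, r) := by simpa using he
  have h8 := val_injective h.irr h7
  simp only [Prod.mk.injEq] at h8
  have := h.two_le'
  omega

theorem leastMissing_mem_gap (h : IsStage n r θ l) :
    (leastMissing (l.map Prod.fst), 1) ∈ gap n r θ := by
  obtain ⟨h1, h2, h3⟩ := h.leastMissing_bounds
  exact mem_gap.mpr ⟨by simp; omega, le_rfl, by simpa using h2, by simpa using h3⟩

theorem one_mem_gap (h : IsStage n r θ l) : (1, r + 1) ∈ gap n r θ := by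
  have := h.lo
  have := h.hi
  refine mem_gap.mpr ⟨le_rfl, by simp, ?_, ?_⟩ <;> push_cast <;> linarith

theorem gap_snd_le (h : IsStage n r θ l) {p : ℕ × ℕ} (hp : p ∈ gap n r θ) : p.2 ≤ r + 1 := by
  obtain ⟨h1, h2, h3, h4⟩ := mem_gap.mp hp
  by_contra hc
  have h5 := h.mul_le (show r + 2 ≤ p.2 by omega)
  have h6 : (1 : ℝ) ≤ p.1 := by exact_mod_cast h1
  have := h.lo
  have := h.two_le_cast
  push_cast at h5
  linarith

theorem gap_eq_one (h : IsStage n r θ l) {p : ℕ × ℕ} (hp : p ∈ gap n r θ) (h1 : p.1 = 1) :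
    p = (1, r + 1) := by
  have h5 := h.gap_snd_le hp
  obtain ⟨-, h2, h3, h4⟩ := mem_gap.mp hp
  rw [h1] at h3
  refine Prod.ext h1 (le_antisymm h5 ?_)
  by_contra hc
  have h5 := h.mul_le (show p.2 ≤ r by simp at hc; omega)
  have := h.two_le_cast
  push_cast at h3
  linarith

/-- The gap is an open interval of length `1`, too short for two pairs in the same row. Since `1 <
θ`, the same holds for columns in `gap_eq_of_fst`. -/
theorem gap_eq_of_snd {p q : ℕ × ℕ} (hp : p ∈ gap n r θ)
    (hq : q ∈ gap n r θ) (h1 : p.2 = q.2) : p = q := by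
  obtain ⟨-, h2, h3, h4⟩ := mem_gap.mp hp
  obtain ⟨-, h2', h3', h4'⟩ := mem_gap.mp hq
  rw [h1] at h3 h4
  refine Prod.ext ?_ h1
  have h5 : (p.1 : ℝ) < q.1 + 1 := by linarith
  have h6 : (q.1 : ℝ) < p.1 + 1 := by linarith
  have h5' : p.1 < q.1 + 1 := by exact_mod_cast h5
  have h6' : q.1 < p.1 + 1 := by exact_mod_cast h6
  omega

theorem gap_eq_of_fst (h : IsStage n r θ l) {p q : ℕ × ℕ} (hp : p ∈ gap n r θ)
    (hq : q ∈ gap n r θ) (h1 : p.1 = q.1) : p = q := by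
  obtain ⟨-, h2, h3, h4⟩ := mem_gap.mp hp
  obtain ⟨-, h2', h3', h4'⟩ := mem_gap.mp hq
  rw [h1] at h3 h4
  have hθ := h.one_lt
  refine Prod.ext h1 ?_
  rcases lt_trichotomy p.2 q.2 with hlt | heq | hlt
  · have := h.mul_le (show p.2 + 1 ≤ q.2 from hlt)
    push_cast at this
    linarith
  · exact heq
  · have := h.mul_le (show q.2 + 1 ≤ p.2 from hlt)
    push_cast at this
    linarith

theorem exists_gap_lists (h : IsStage n r θ l) : ∃ u, Lists θ (gap n r θ) u := by
  refine exists_lists h.irr h.pos (val θ (n + 1, r)) fun p hp => ?_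
  exact ⟨hp.1, hp.2.1, hp.2.2.2.le⟩

/-- The terms of `t` come from the pairs between `(n - 1, r)` and `(n, r)`. Translation by `(1, 0)`
takes these into the gap and misses only the pair there with first component `1`. -/
theorem seqT_eq (h : IsStage n r θ l) {A B : List (ℕ × ℕ)}
    (hu : Lists θ (gap n r θ) (A ++ (1, r + 1) :: B)) :
    seqT n (l.map Prod.fst) = (A ++ B).map Prod.fst := by
  have hn := h.two_le
  have hr := h.two_le'
  have hθ := h.one_lt
  have hn' : ((n - 1 : ℕ) : ℝ) = n - 1 := by push_cast [Nat.cast_sub (show 1 ≤ n by omega)]; rfl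
  obtain ⟨L₁, R₁, e1, hL₁, hR₁⟩ := h.lists.split (x := (n, r))
    ⟨by simp; omega, by simp; omega, Set.mem_Iic.mpr le_rfl⟩
  have hR₁' : R₁ = [] := List.eq_nil_iff_forall_not_mem.mpr fun p hp => by
    have := (hR₁.mem p).mp hp
    exact absurd this.1.2.2 (not_le.mpr this.2)
  obtain ⟨L₂, M, e2, hL₂, hM⟩ := hL₁.split (x := (n - 1, r)) (by
    refine ⟨⟨by simp; omega, by simp; omega, ?_⟩, ?_⟩ <;> simp [hn'])
  have e3 : l.map Prod.fst = (L₂.map Prod.fst ++ (n - 1) :: M.map Prod.fst) ++ n :: [] := by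
    rw [e1, hR₁', e2]; simp
  have hM' : n - 1 ∉ M.map Prod.fst := hM.fst_notMem fun j hj => by
    obtain ⟨⟨⟨h1, h2, h3⟩, h4⟩, h5⟩ := hj
    simp only [val_mk, hn', Set.mem_Iic] at h3 h4 h5
    have h6 : r < j := by
      by_contra hc
      have := h.mul_le (not_lt.mp hc)
      linarith
    have := h.mul_le (show r + 1 ≤ j from h6)
    push_cast at this
    linarith
  rw [seqT, e3, beforeLast_append_cons _ (by simp), afterLast_append_cons _ hM', List.map_map]
  have key : M.map (· + (1, 0)) = A ++ B := by
    refine (hM.map_add (1, 0)).eq (hu.remove.congr fun p => ?_)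
    simp only [Set.mem_ofPred_eq, seg, Set.mem_Iic, val, hn', mem_gap]
    constructor
    · rintro ⟨hp, hne⟩
      have hp1 : p.1 ≠ 1 := fun he => hne (h.gap_eq_one (mem_gap.mpr hp) he)
      obtain ⟨h1, h2, h3, h4⟩ := hp
      have h5 : ((p.1 - 1 : ℕ) : ℝ) = p.1 - 1 := by push_cast [Nat.cast_sub h1]; rfl
      refine ⟨(p.1 - 1, p.2), ⟨⟨⟨by simp; omega, h2, ?_⟩, ?_⟩, ?_⟩, ?_⟩
      · simp only [h5]; linarith
      · simp only [h5]; linarith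
      · simp only [h5]; linarith
      · ext <;> simp; omega
    · rintro ⟨q, ⟨⟨⟨h1, h2, h3⟩, h4⟩, h5⟩, rfl⟩
      simp only [Prod.fst_add, Prod.snd_add, Nat.cast_add, Nat.cast_one, add_zero]
      refine ⟨⟨by omega, h2, by linarith, by linarith⟩, fun he => ?_⟩
      have := congrArg Prod.fst he
      simp at this
      omega
  rw [← key, List.map_map]
  rfl

/-- Since `1 < θ`, the last `n + 1` belongs to `(n + 1, r - 1)`, and the last `n` before it to `(n,
r - 1)`. Translation by `(0, 1)` takes the pairs between them into the gap and misses only the pair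
with second component `1`. -/
theorem seqT'_eq (h : IsStage n r θ l) {A B : List (ℕ × ℕ)}
    (hu : Lists θ (gap n r θ) (A ++ (leastMissing (l.map Prod.fst), 1) :: B)) :
    seqT' n (l.map Prod.fst) = (A ++ B).map Prod.fst := by
  have hn := h.two_le
  have hr := h.two_le'
  have hθ := h.one_lt
  have hr' : ((r - 1 : ℕ) : ℝ) = r - 1 := by push_cast [Nat.cast_sub (show 1 ≤ r by omega)]; rfl
  obtain ⟨L₁, R₁, e1, hL₁, hR₁⟩ := h.lists.split (x := (n + 1, r - 1)) (by
    refine ⟨by simp, by simp; omega, ?_⟩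
    simp [hr']
    linarith)
  have hR₁' : n + 1 ∉ R₁.map Prod.fst := hR₁.fst_notMem fun j hj => by
    obtain ⟨⟨h1, h2, h3⟩, h4⟩ := hj
    simp only [val_mk, hr', Set.mem_Iic] at h3 h4
    push_cast at h3 h4
    have h6 : r ≤ j := by
      by_contra hc
      have := h.mul_le (show j ≤ r - 1 by omega)
      rw [hr'] at this
      linarith
    have := h.mul_le h6
    linarith
  obtain ⟨L₂, M, e2, hL₂, hM⟩ := hL₁.split (x := (n, r - 1)) (by
    refine ⟨⟨by simp; omega, by simp; omega, ?_⟩, ?_⟩ <;> simp [hr']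
    linarith)
  have e3 : l.map Prod.fst =
      (L₂.map Prod.fst ++ n :: M.map Prod.fst) ++ (n + 1) :: R₁.map Prod.fst := by
    rw [e1, e2]; simp
  have hM' : n ∉ M.map Prod.fst := hM.fst_notMem fun j hj => by
    obtain ⟨⟨⟨h1, h2, h3⟩, h4⟩, h5⟩ := hj
    simp only [val_mk, hr', Set.mem_Iic] at h3 h4 h5
    push_cast at h4
    have h6 : r ≤ j := by
      by_contra hc
      have := h.mul_le (show j ≤ r - 1 by omega)
      rw [hr'] at this
      linarith
    have := h.mul_le h6
    linarith
  rw [seqT', e3, beforeLast_append_cons _ hR₁', afterLast_append_cons _ hM']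
  have key : M.map (· + (0, 1)) = A ++ B := by
    refine (hM.map_add (0, 1)).eq (hu.remove.congr fun p => ?_)
    simp only [Set.mem_ofPred_eq, seg, Set.mem_Iic, val, hr', mem_gap]
    constructor
    · rintro ⟨hp, hne⟩
      have hp1 : p.2 ≠ 1 := fun he =>
        hne (gap_eq_of_snd (mem_gap.mpr hp) h.leastMissing_mem_gap he)
      obtain ⟨h1, h2, h3, h4⟩ := hp
      have h5 : ((p.2 - 1 : ℕ) : ℝ) = p.2 - 1 := by push_cast [Nat.cast_sub h2]; rfl
      refine ⟨(p.1, p.2 - 1), ⟨⟨⟨h1, by simp; omega, ?_⟩, ?_⟩, ?_⟩, ?_⟩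
      · simp only [h5]; linarith
      · simp only [h5]; push_cast; linarith
      · simp only [h5]; linarith
      · ext <;> simp; omega
    · rintro ⟨q, ⟨⟨⟨h1, h2, h3⟩, h4⟩, h5⟩, rfl⟩
      push_cast at h4
      simp only [Prod.fst_add, Prod.snd_add, Nat.cast_add, Nat.cast_one, add_zero]
      refine ⟨⟨by omega, by omega, by linarith, by linarith⟩, fun he => ?_⟩
      have := congrArg Prod.snd he
      simp at this
      omega
  rw [← key, List.map_map]
  congr 1

/-- A change of the slope as in `exists_flip` preserves the stage, and interchanges the two
neighbours in the gap. -/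
theorem flip (h : IsStage n r θ l) {x y : ℕ × ℕ} {A D : List (ℕ × ℕ)}
    (hu : Lists θ (gap n r θ) (A ++ x :: y :: D))
    (hxy : (x = (leastMissing (l.map Prod.fst), 1) ∧ y = (1, r + 1)) ∨
      (x = (1, r + 1) ∧ y = (leastMissing (l.map Prod.fst), 1))) :
    ∃ θ', IsStage n r θ' l ∧ Lists θ' (gap n r θ') (A ++ y :: x :: D) := by
  have hn := h.two_le
  have hr := h.two_le'
  have hs := hu.sorted
  simp only [List.pairwise_append, List.pairwise_cons, List.mem_cons] at hs
  obtain ⟨s1, ⟨s2, s3, s4⟩, s5⟩ := hs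
  have hgx : x ∈ gap n r θ := (hu.mem x).mp (by simp)
  have hgy : y ∈ gap n r θ := (hu.mem y).mp (by simp)
  -- Neighbours in the listing of the gap are neighbours among all pairs, because the gap contains
  -- every pair in its interval.
  have hbtw : ∀ p : ℕ × ℕ, 1 ≤ p.1 → 1 ≤ p.2 → ¬ (val θ x < val θ p ∧ val θ p < val θ y) := by
    rintro p hp1 hp2 ⟨h1, h2⟩
    have hp : p ∈ gap n r θ := ⟨hp1, hp2, hgx.2.2.1.trans h1, h2.trans hgy.2.2.2⟩
    have := (hu.mem p).mpr hp
    simp only [List.mem_append, List.mem_cons] at this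
    rcases this with h3 | rfl | rfl | h3
    · exact absurd h1 (s5 p h3 x (Or.inl rfl)).not_gt
    · exact lt_irrefl _ h1
    · exact lt_irrefl _ h2
    · exact absurd h2 (s3 p h3).not_gt
  have hxy' : val θ x < val θ y := s2 y (Or.inl rfl)
  obtain ⟨hℓ, -, -⟩ := h.leastMissing_bounds
  obtain ⟨θ', hirr, hcmp, hfl⟩ := exists_flip h.irr h.pos (show 1 ≤ r by omega) hℓ (by
    intro p hp1 hp2
    rcases hxy with ⟨rfl, rfl⟩ | ⟨rfl, rfl⟩
    · exact ⟨hbtw p hp1 hp2, fun hc => absurd (hc.1.trans hc.2) hxy'.not_gt⟩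
    · exact ⟨fun hc => absurd (hc.1.trans hc.2) hxy'.not_gt, hbtw p hp1 hp2⟩)
  have hne : val θ' (1, r + 1) ≠ val θ' (leastMissing (l.map Prod.fst), 1) := fun he => by
    have := val_injective hirr he
    simp only [Prod.mk.injEq] at this
    omega
  have hyx : val θ' y < val θ' x := by
    rcases hxy with ⟨rfl, rfl⟩ | ⟨rfl, rfl⟩
    · exact hfl.mp hxy'
    · by_contra hc
      exact absurd (hfl.mpr ((not_lt.mp hc).lt_of_ne hne)) hxy'.not_gt
  -- The bounds on the slope are comparisons of `(1, 2)` with `(n, 1)` and `(n + 1, 1)`; their rows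
  -- differ by `1 < r`, so they persist.
  have hlo : (n : ℝ) - 1 < θ' := by
    have h1 := (hcmp (n, 1) (1, 2) (by simp; omega) (by simp; omega)).mp (by
      simp only [val_mk]; push_cast; linarith [h.lo])
    simp only [val_mk] at h1
    push_cast at h1
    linarith
  have hhi : θ' < n := by
    have h1 := (hcmp (1, 2) (n + 1, 1) (by simp; omega) (by simp; omega)).mp (by
      simp only [val_mk]; push_cast; linarith [h.hi])
    simp only [val_mk] at h1
    push_cast at h1
    linarith
  have h2n : (2 : ℝ) ≤ n := h.two_le_cast
  have hsnd : ∀ {ϑ : ℝ}, (n : ℝ) - 1 < ϑ → ∀ p : ℕ × ℕ, 1 ≤ p.1 →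
      val ϑ p < val ϑ (n + 1, r) → p.2 ≤ r + 1 := by
    intro ϑ hϑ p hp hv
    by_contra hc
    have h5 := natCast_mul_le (show 0 < ϑ by linarith) (show r + 2 ≤ p.2 by omega)
    have h6 : (1 : ℝ) ≤ p.1 := by exact_mod_cast hp
    simp only [val] at hv
    push_cast at h5 hv
    linarith
  have hl : ∀ p ∈ l, p.2 ≤ r := fun p hp => by
    obtain ⟨h1, h2, h3⟩ := h.mem.mp hp
    by_contra hc
    have h5 := h.mul_le (show r + 1 ≤ p.2 by omega)
    have h6 : (1 : ℝ) ≤ p.1 := by exact_mod_cast h1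
    have := h.lo
    push_cast at h5
    linarith
  have hcmp' : ∀ p : ℕ × ℕ, 1 ≤ p.1 → 1 ≤ p.2 → ∀ m, (val θ p < val θ (n + 1, r) ∨
      val θ' p < val θ' (n + 1, r)) → ((val θ p < val θ (m, r) ↔ val θ' p < val θ' (m, r)) ∧
      (val θ (m, r) < val θ p ↔ val θ' (m, r) < val θ' p)) := by
    intro p hp1 hp2 m hv
    have : p.2 ≤ r + 1 := hv.elim (hsnd h.lo p hp1) (hsnd hlo p hp1)
    exact ⟨hcmp _ _ (by simp; omega) (by simp; omega), hcmp _ _ (by simp; omega) (by simp; omega)⟩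
  refine ⟨θ', ⟨h.two_le, h.two_le', hirr, hlo, hhi, ?_, fun p => ?_⟩, ?_, fun p => ?_⟩
  · refine h.lists.sorted.imp_of_mem fun {p q} hp hq hlt => ?_
    have h1 := hl p hp
    have h2 := hl q hq
    have h3 := (h.mem.mp hp).2.1
    have h4 := (h.mem.mp hq).2.1
    exact (hcmp p q (by omega) (by omega)).mp hlt
  · have e : ∀ ϑ : ℝ, val ϑ (n, r) < val ϑ (n + 1, r) := fun ϑ => by simp
    rw [h.lists.mem]
    simp only [seg, Set.mem_ofPred_eq, Set.mem_Iic]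
    refine and_congr_right fun hp1 => and_congr_right fun hp2 => ⟨fun hv => ?_, fun hv => ?_⟩
    · have := (hcmp' p hp1 hp2 n (Or.inl (hv.trans_lt (e θ)))).2
      exact not_lt.mp fun hc => absurd hv (not_le.mpr (this.mpr hc))
    · have := (hcmp' p hp1 hp2 n (Or.inr (hv.trans_lt (e θ')))).2
      exact not_lt.mp fun hc => absurd hv (not_le.mpr (this.mp hc))
  · have hx2 : x.2 = 1 ∧ y.2 = r + 1 ∨ x.2 = r + 1 ∧ y.2 = 1 := by
      rcases hxy with ⟨rfl, rfl⟩ | ⟨rfl, rfl⟩ <;> simp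
    -- Rows `1` and `r + 1` of the gap are occupied by `x` and `y` alone, so every comparison other
    -- than that of `x` with `y` involves rows differing by less than `r`.
    have hrest : ∀ p ∈ A ++ D, 2 ≤ p.2 ∧ p.2 ≤ r := by
      intro p hp
      have hpx : p ≠ x ∧ p ≠ y := by
        have hnd := hu.nodup
        have hnd' : (x :: y :: (A ++ D)).Nodup := by
          refine (List.Perm.nodup_iff ?_).mp hnd
          exact List.perm_middle.trans (List.Perm.cons _ List.perm_middle)
        simp only [List.nodup_cons, List.mem_cons, not_or] at hnd'
        exact ⟨fun he => hnd'.1.2 (he ▸ hp), fun he => hnd'.2.1 (he ▸ hp)⟩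
      have hpg : p ∈ gap n r θ := (hu.mem p).mp (by
        simp only [List.mem_append, List.mem_cons] at hp ⊢
        tauto)
      have h1 := h.gap_snd_le hpg
      have h2 := hpg.2.1
      have h3 : p.2 ≠ x.2 := fun he => hpx.1 (gap_eq_of_snd hpg hgx he)
      have h4 : p.2 ≠ y.2 := fun he => hpx.2 (gap_eq_of_snd hpg hgy he)
      omega
    have hAD : ∀ p ∈ A ++ D, ∀ q, 1 ≤ q.2 → q.2 ≤ r + 1 →
        (val θ p < val θ q ↔ val θ' p < val θ' q) ∧ (val θ q < val θ p ↔ val θ' q < val θ' p) := by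
      intro p hp q h3 h4
      have := hrest p hp
      exact ⟨hcmp p q (by omega) (by omega), hcmp q p (by omega) (by omega)⟩
    have hA : ∀ p ∈ A, p ∈ A ++ D := fun p hp => by simp [hp]
    have hD : ∀ p ∈ D, p ∈ A ++ D := fun p hp => by simp [hp]
    have hAD2 : ∀ p ∈ A ++ D, 1 ≤ p.2 ∧ p.2 ≤ r + 1 := fun p hp => by
      have := hrest p hp
      omega
    simp only [List.pairwise_append, List.pairwise_cons, List.mem_cons]
    have hx3 : 1 ≤ x.2 ∧ x.2 ≤ r + 1 := by omega
    have hy3 : 1 ≤ y.2 ∧ y.2 ≤ r + 1 := by omega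
    refine ⟨?_, ⟨?_, ?_, ?_⟩, ?_⟩
    · exact s1.imp_of_mem fun {p q} hp hq hlt =>
        (hAD p (hA p hp) q (hAD2 q (hA q hq)).1 (hAD2 q (hA q hq)).2).1.mp hlt
    · rintro p (rfl | hp)
      · exact hyx
      · exact (hAD p (hD p hp) y hy3.1 hy3.2).2.mp (s3 p hp)
    · exact fun p hp => (hAD p (hD p hp) x hx3.1 hx3.2).2.mp (s2 p (Or.inr hp))
    · exact s4.imp_of_mem fun {p q} hp hq hlt =>
        (hAD p (hD p hp) q (hAD2 q (hD q hq)).1 (hAD2 q (hD q hq)).2).1.mp hlt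
    · rintro p hp q (rfl | rfl | hq)
      · exact (hAD p (hA p hp) q hy3.1 hy3.2).1.mp (s5 p hp q (Or.inr (Or.inl rfl)))
      · exact (hAD p (hA p hp) q hx3.1 hx3.2).1.mp (s5 p hp q (Or.inl rfl))
      · exact (hAD p (hA p hp) q (hAD2 q (hD q hq)).1 (hAD2 q (hD q hq)).2).1.mp
          (s5 p hp q (Or.inr (Or.inr hq)))
  · have : p ∈ A ++ y :: x :: D ↔ p ∈ A ++ x :: y :: D := by
      simp only [List.mem_append, List.mem_cons]
      tauto
    rw [this, hu.mem]
    simp only [gap, seg, Set.mem_ofPred_eq, Set.mem_Ioo]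
    refine and_congr_right fun hp1 => and_congr_right fun hp2 => ⟨fun hv => ?_, fun hv => ?_⟩
    · exact ⟨(hcmp' p hp1 hp2 n (Or.inl hv.2)).2.mp hv.1,
        (hcmp' p hp1 hp2 (n + 1) (Or.inl hv.2)).1.mp hv.2⟩
    · exact ⟨(hcmp' p hp1 hp2 n (Or.inr hv.2)).2.mpr hv.1,
        (hcmp' p hp1 hp2 (n + 1) (Or.inr hv.2)).1.mpr hv.2⟩

/-- The merged sequence consists of the first components of the pairs in the gap, for some slope
that is compatible with the stage. -/
theorem exists_merge (h : IsStage n r θ l) (c : Bool) : ∃ θ' u, IsStage n r θ' l ∧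
    Lists θ' (gap n r θ') u ∧
    merge (leastMissing (l.map Prod.fst)) (seqT n (l.map Prod.fst)) (seqT' n (l.map Prod.fst)) c =
      u.map Prod.fst := by
  obtain ⟨hℓ, -, -⟩ := h.leastMissing_bounds
  obtain ⟨u, hu⟩ := h.exists_gap_lists
  have hinj : ∀ {A B : List (ℕ × ℕ)} {x : ℕ × ℕ}, Lists θ (gap n r θ) (A ++ x :: B) →
      x.1 ∉ A.map Prod.fst ∧ x.1 ∉ B.map Prod.fst := by
    intro A B x hu'
    have hnd := hu'.nodup
    simp only [List.nodup_append, List.nodup_cons, List.mem_cons] at hnd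
    have hx := (hu'.mem x).mp (by simp)
    constructor
    · intro hm
      obtain ⟨p, hp, he⟩ := List.mem_map.mp hm
      exact hnd.2.2 p hp x (Or.inl rfl) (h.gap_eq_of_fst ((hu'.mem p).mp (by simp [hp])) hx he)
    · intro hm
      obtain ⟨p, hp, he⟩ := List.mem_map.mp hm
      exact hnd.2.1.1 ((h.gap_eq_of_fst ((hu'.mem p).mp (by simp [hp])) hx he) ▸ hp)
  rcases lt_or_ge (val θ (leastMissing (l.map Prod.fst), 1)) (val θ (1, r + 1)) with hlt | hge
  · obtain ⟨A, B, e1, hA, hB⟩ := hu.split h.leastMissing_mem_gap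
    obtain ⟨C, D, e2, hC, hD⟩ := hB.split (x := (1, r + 1)) ⟨h.one_mem_gap, hlt⟩
    subst e2
    subst e1
    have e3 : A ++ (leastMissing (l.map Prod.fst), 1) :: (C ++ (1, r + 1) :: D) =
        (A ++ (leastMissing (l.map Prod.fst), 1) :: C) ++ (1, r + 1) :: D := by simp
    have f1 := hinj hu
    have f2 := hinj (e3 ▸ hu)
    have ht := h.seqT_eq (e3 ▸ hu)
    have ht' := h.seqT'_eq hu
    simp only [List.map_append, List.map_cons, List.append_assoc, List.cons_append,
      List.mem_append, List.mem_cons, not_or] at f1 f2 ht ht'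
    rw [ht, ht', ← List.append_assoc (A.map Prod.fst) (C.map Prod.fst),
      merge_of_lt c f1.1 f2.1.1 f2.1.2.2]
    -- The slope has to change only if the pairs are neighbours and the choice `c` reverses their
    -- order.
    split_ifs with hC' hc'
    · have : C = [] := List.map_eq_nil_iff.mp hC'
      subst this
      obtain ⟨θ', h1, h2⟩ := h.flip hu (Or.inl ⟨rfl, rfl⟩)
      exact ⟨θ', _, h1, h2, by simp⟩
    · exact ⟨θ, _, h, hu, by simp [hC']⟩
    · exact ⟨θ, _, h, hu, by simp⟩
  · have hlt : val θ (1, r + 1) < val θ (leastMissing (l.map Prod.fst), 1) := by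
      refine hge.lt_of_ne fun he => ?_
      have := val_injective h.irr he
      simp only [Prod.mk.injEq] at this
      omega
    obtain ⟨A, B, e1, hA, hB⟩ := hu.split h.one_mem_gap
    obtain ⟨C, D, e2, hC, hD⟩ :=
      hB.split (x := (leastMissing (l.map Prod.fst), 1)) ⟨h.leastMissing_mem_gap, hlt⟩
    subst e2
    subst e1
    have e3 : A ++ (1, r + 1) :: (C ++ (leastMissing (l.map Prod.fst), 1) :: D) =
        (A ++ (1, r + 1) :: C) ++ (leastMissing (l.map Prod.fst), 1) :: D := by simp
    have f1 := hinj hu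
    have f2 := hinj (e3 ▸ hu)
    have ht := h.seqT_eq hu
    have ht' := h.seqT'_eq (e3 ▸ hu)
    simp only [List.map_append, List.map_cons, List.append_assoc, List.cons_append,
      List.mem_append, List.mem_cons, not_or] at f1 f2 ht ht'
    rw [ht, ht', ← List.append_assoc (A.map Prod.fst) (C.map Prod.fst),
      merge_of_gt c f2.1.1 f2.1.2.2 f1.1]
    split_ifs with hC' hc'
    · exact ⟨θ, _, h, hu, by simp [hC']⟩
    · have : C = [] := List.map_eq_nil_iff.mp hC'
      subst this
      obtain ⟨θ', h1, h2⟩ := h.flip hu (Or.inr ⟨rfl, rfl⟩)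
      exact ⟨θ', _, h1, h2, by simp⟩
    · exact ⟨θ, _, h, hu, by simp⟩

end IsStage

end Stages

end Kimberling

namespace Kimberling

/-! ### Rewriting the last block -/

section Rewriting

/-- The pairs from `(1, r + 1)` to `(n, r + 1)`, except those pairs `(i, 1)` for which
`ℓ + s ≤ i`. -/
def partialBlock (n r : ℕ) (θ : ℝ) (ℓ s : ℕ) : Set (ℕ × ℕ) :=
  {p | p ∈ seg θ (Set.Icc (val θ (1, r + 1)) (val θ (n, r + 1))) ∧ (2 ≤ p.2 ∨ p.1 < ℓ + s)}

theorem mem_partialBlock {n r ℓ s : ℕ} {θ : ℝ} {p : ℕ × ℕ} : p ∈ partialBlock n r θ ℓ s ↔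
    1 ≤ p.1 ∧ 1 ≤ p.2 ∧ 1 + (r + 1) * θ ≤ p.1 + p.2 * θ ∧
      (p.1 : ℝ) + p.2 * θ ≤ n + (r + 1) * θ ∧ (2 ≤ p.2 ∨ p.1 < ℓ + s) := by
  simp [partialBlock, seg, val, and_assoc]

theorem Lists.insert_partialBlock {n r ℓ s : ℕ} {θ : ℝ} {A B : List (ℕ × ℕ)}
    (hA : Lists θ {p | p ∈ partialBlock n r θ ℓ s ∧ val θ p < val θ (ℓ + s, 1)} A)
    (hB : Lists θ {p | p ∈ partialBlock n r θ ℓ s ∧ val θ (ℓ + s, 1) < val θ p} B)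
    (hθ : Irrational θ) (hℓ : 1 ≤ ℓ) (h1 : 1 + (r + 1) * θ ≤ ℓ + s + θ)
    (h2 : ℓ + s + θ ≤ n + (r + 1) * θ) :
    Lists θ (partialBlock n r θ ℓ (s + 1)) (A ++ (ℓ + s, 1) :: B) := by
  have h3 := (Lists.singleton θ (ℓ + s, 1)).append hB (by
    rintro p rfl q hq
    exact hq.2)
  refine (hA.append h3 ?_).congr fun p => ?_
  · rintro p hp q (rfl | hq)
    · exact hp.2
    · exact hp.2.trans hq.2
  · simp only [Set.mem_union, Set.mem_ofPred_eq, Set.mem_singleton_iff]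
    constructor
    · rintro (⟨h, -⟩ | rfl | ⟨h, -⟩)
      · rw [mem_partialBlock] at h ⊢
        exact ⟨h.1, h.2.1, h.2.2.1, h.2.2.2.1, h.2.2.2.2.imp id (by omega)⟩
      · rw [mem_partialBlock]
        refine ⟨by simp; omega, le_rfl, ?_, ?_, Or.inr (by simp)⟩ <;> push_cast <;> linarith
      · rw [mem_partialBlock] at h ⊢
        exact ⟨h.1, h.2.1, h.2.2.1, h.2.2.2.1, h.2.2.2.2.imp id (by omega)⟩
    · intro h
      by_cases hp : p = (ℓ + s, 1)
      · exact Or.inr (Or.inl hp)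
      · have h' : p ∈ partialBlock n r θ ℓ s := by
          rw [mem_partialBlock] at h ⊢
          refine ⟨h.1, h.2.1, h.2.2.1, h.2.2.2.1, ?_⟩
          by_contra hc
          exact hp (Prod.ext (by simp; omega) (by simp; omega))
        rcases ((val_injective hθ).ne hp).lt_or_gt with h4 | h4
        · exact Or.inl ⟨h', h4⟩
        · exact Or.inr (Or.inr ⟨h', h4⟩)

namespace IsStage

variable {n r ℓ s : ℕ} {θ : ℝ} {l u y A B C D : List (ℕ × ℕ)}

/-- An integer appears first in row `1`. The pairs `(i, 1)` with `ℓ ≤ i < ℓ + s` have been written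
either in the part `A` of the gap or in the block so far, while a pair `(ℓ + s, j)` with `2 ≤ j` is
beyond the end of the block. -/
theorem leastMissing_eq_add (h : IsStage n r θ l) (hℓ : ℓ = leastMissing (l.map Prod.fst))
    (hA : Lists θ {p | p ∈ gap n r θ ∧ val θ p < val θ (1, r + 1)} A)
    (hy : Lists θ (partialBlock n r θ ℓ s) y) (hs : s < n) (h1 : 1 + (r + 1) * θ < ℓ + s + θ) :
    leastMissing ((l ++ A).map Prod.fst ++ y.map Prod.fst) = ℓ + s := by
  obtain ⟨b1, b2, b3⟩ := h.leastMissing_bounds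
  rw [← hℓ] at b1 b2 b3
  have hlo := h.lo
  have hhi := h.hi
  have hs' : (s : ℝ) + 1 ≤ n := by exact_mod_cast hs
  refine leastMissing_eq (by omega) ?_ fun i hi hlt => ?_
  · rw [← List.map_append]
    intro hm
    obtain ⟨⟨i, j⟩, hp, rfl⟩ := List.mem_map.mp hm
    simp only [List.mem_append, h.mem, hA.mem, hy.mem, mem_partialBlock, Set.mem_ofPred_eq,
      mem_gap, val_mk] at hp
    rcases hp with (⟨h2, h3, h4⟩ | ⟨⟨h2, h3, h4⟩, h5⟩) | ⟨h2, h3, h4, h5, h6⟩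
    · have h7 := h.mul_le h3
      push_cast at h7 h4
      linarith
    · have h7 := h.mul_le h3
      push_cast at h7 h5
      linarith
    · have h7 := h.mul_le (show 2 ≤ j by omega)
      push_cast at h7 h5
      have : (0 : ℝ) ≤ s := by positivity
      linarith
  · rcases lt_or_ge i ℓ with h2 | h2
    · have := mem_of_lt_leastMissing hi (hℓ ▸ h2)
      simp only [List.map_append, List.mem_append]
      exact Or.inl (Or.inl this)
    · have h2' : (ℓ : ℝ) ≤ i := by exact_mod_cast h2
      have h3 : (i : ℝ) + 1 ≤ ℓ + s := by exact_mod_cast hlt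
      rw [← List.map_append]
      refine List.mem_map.mpr ⟨(i, 1), ?_, rfl⟩
      simp only [List.mem_append, hA.mem, hy.mem, mem_partialBlock, Set.mem_ofPred_eq,
        mem_gap, val_mk]
      push_cast
      rcases lt_or_ge ((i : ℝ) + θ) (1 + (r + 1) * θ) with h4 | h4
      · exact Or.inl (Or.inr ⟨⟨hi, trivial, by linarith, by linarith⟩, by linarith⟩)
      · exact Or.inr ⟨hi, trivial, by linarith, by linarith, Or.inr hlt⟩

/-- The pairs between `(1, r + 1)` and `(ℓ, 1)`, translated by `(s, 0)`. -/
theorem translate_of_lt (h : IsStage n r θ l) (hℓ : ℓ = leastMissing (l.map Prod.fst))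
    (hC : Lists θ {p | (p ∈ gap n r θ ∧ val θ (1, r + 1) < val θ p) ∧ val θ p < val θ (ℓ, 1)} C)
    (hD : Lists θ {p | (p ∈ partialBlock n r θ ℓ s ∧ val θ (s + 1, r + 1) < val θ p) ∧
      val θ p < val θ (ℓ + s, 1)} D) (hs : s + 1 < n) : D.length = C.length := by
  obtain ⟨b1, b2, b3⟩ := h.leastMissing_bounds
  rw [← hℓ] at b1 b2 b3
  have hlo := h.lo
  have hhi := h.hi
  have hθ := h.pos
  have hs' : (s : ℝ) + 2 ≤ n := by exact_mod_cast hs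
  have hs0 : (0 : ℝ) ≤ s := by positivity
  suffices key : C.map (· + (s, 0)) = D by rw [← key, List.length_map]
  refine (hC.map_add (s, 0)).eq (hD.congr fun p => ?_)
  simp only [Set.mem_ofPred_eq, mem_partialBlock, mem_gap, val]
  push_cast
  constructor
  · rintro ⟨⟨⟨h1, h2, h3, h4, h5⟩, h6⟩, h7⟩
    -- No pair of the interval lies outside the translated quadrant: with first component at most
    -- `s`, rows up to `r + 1` come too early, and later rows too late because `n - 1 < θ`.
    have h8 : s + 1 ≤ p.1 := by
      by_contra hc
      have h9 : (p.1 : ℝ) ≤ s := by exact_mod_cast (show p.1 ≤ s by omega)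
      have h10 : r + 2 ≤ p.2 := by
        by_contra hc'
        have := h.mul_le (show p.2 ≤ r + 1 by omega)
        push_cast at this
        linarith
      have h11 := h.mul_le h10
      have h12 : (1 : ℝ) ≤ p.1 := by exact_mod_cast h1
      push_cast at h11
      linarith
    refine ⟨(p.1 - s, p.2), ?_, by ext <;> simp; omega⟩
    have h9 : ((p.1 - s : ℕ) : ℝ) = p.1 - s := by
      push_cast [Nat.cast_sub (show s ≤ p.1 by omega)]; rfl
    simp only [h9]
    refine ⟨⟨⟨by omega, h2, ?_, ?_⟩, ?_⟩, ?_⟩ <;> linarith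
  · rintro ⟨q, ⟨⟨⟨h1, h2, h3, h4⟩, h5⟩, h6⟩, rfl⟩
    simp only [Prod.fst_add, Prod.snd_add, add_zero]
    push_cast
    refine ⟨⟨⟨by omega, h2, by linarith, by linarith, ?_⟩, by linarith⟩, by linarith⟩
    by_contra hc
    have h7 : q.2 = 1 := by omega
    have h8 : (ℓ : ℝ) ≤ q.1 := by exact_mod_cast (show ℓ ≤ q.1 by omega)
    rw [h7] at h6
    push_cast at h6
    linarith

/-- The pairs between `(ℓ, 1)` and `(1, r + 1)`, translated by `(s, 0)`. -/
theorem translate_of_gt (h : IsStage n r θ l) (hℓ : ℓ = leastMissing (l.map Prod.fst))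
    (hC : Lists θ {p | (p ∈ gap n r θ ∧ val θ (ℓ, 1) < val θ p) ∧ val θ p < val θ (1, r + 1)} C)
    (hD : Lists θ {p | (p ∈ partialBlock n r θ ℓ s ∧ val θ p < val θ (s + 1, r + 1)) ∧
      val θ (ℓ + s, 1) < val θ p} D) (h0 : 1 ≤ s) (hs : s < n) : D.length = C.length := by
  obtain ⟨b1, b2, b3⟩ := h.leastMissing_bounds
  rw [← hℓ] at b1 b2 b3
  have hlo := h.lo
  have hhi := h.hi
  have hθ := h.pos
  have hs' : (s : ℝ) + 1 ≤ n := by exact_mod_cast hs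
  have hs0 : (1 : ℝ) ≤ s := by exact_mod_cast h0
  suffices key : C.map (· + (s, 0)) = D by rw [← key, List.length_map]
  refine (hC.map_add (s, 0)).eq (hD.congr fun p => ?_)
  simp only [Set.mem_ofPred_eq, mem_partialBlock, mem_gap, val]
  push_cast
  constructor
  · rintro ⟨⟨⟨h1, h2, h3, h4, h5⟩, h6⟩, h7⟩
    have h12 : (1 : ℝ) ≤ p.1 := by exact_mod_cast h1
    have h8 : s + 1 ≤ p.1 := by
      by_contra hc
      have h9 : (p.1 : ℝ) ≤ s := by exact_mod_cast (show p.1 ≤ s by omega)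
      rcases Nat.lt_or_ge p.2 (r + 2) with h10 | h10
      · have := h.mul_le (show p.2 ≤ r + 1 by omega)
        push_cast at this
        linarith
      · have := h.mul_le h10
        push_cast at this
        linarith
    refine ⟨(p.1 - s, p.2), ?_, by ext <;> simp; omega⟩
    have h9 : ((p.1 - s : ℕ) : ℝ) = p.1 - s := by
      push_cast [Nat.cast_sub (show s ≤ p.1 by omega)]; rfl
    simp only [h9]
    refine ⟨⟨⟨by omega, h2, ?_, ?_⟩, ?_⟩, ?_⟩ <;> linarith
  · rintro ⟨q, ⟨⟨⟨h1, h2, h3, h4⟩, h5⟩, h6⟩, rfl⟩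
    simp only [Prod.fst_add, Prod.snd_add, add_zero]
    push_cast
    refine ⟨⟨⟨by omega, h2, by linarith, by linarith, Or.inl ?_⟩, by linarith⟩, by linarith⟩
    by_contra hc
    have h7 : q.2 = 1 := by omega
    rw [h7] at h5 h6
    push_cast at h5 h6
    have h8 : (ℓ : ℝ) < q.1 := by linarith
    have h9 : (q.1 : ℝ) < ℓ + 1 := by linarith
    have h8' : ℓ < q.1 := by exact_mod_cast h8
    have h9' : q.1 < ℓ + 1 := by exact_mod_cast h9
    omega

/-- The displacement from `(s + 1, r + 1)` to `(ℓ + s, 1)` does not depend on `s`, and neither does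
the number of pairs in between, as long as the new pair is inside the block. Hence the position
prescribed by `d` is the one required by the order; when the new pair is outside the block, the
range test fails. -/
theorem exists_insertNear (h : IsStage n r θ l) (hℓ : ℓ = leastMissing (l.map Prod.fst))
    (hu : Lists θ (gap n r θ) u)
    (hA : Lists θ {p | p ∈ gap n r θ ∧ val θ p < val θ (1, r + 1)} A)
    (hy : Lists θ (partialBlock n r θ ℓ s) y) (hs : s < n) :
    ∃ y', Lists θ (partialBlock n r θ ℓ (s + 1)) y' ∧
      insertNear (((u.map Prod.fst).idxOf 1 : ℤ) - ((u.map Prod.fst).idxOf ℓ : ℤ))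
        ((l ++ A).map Prod.fst) (y.map Prod.fst) (s + 1) = y'.map Prod.fst := by
  obtain ⟨b1, b2, b3⟩ := h.leastMissing_bounds
  have hgℓ := h.leastMissing_mem_gap
  have hg1 := h.one_mem_gap
  rw [← hℓ] at b1 b2 b3 hgℓ
  have hlo := h.lo
  have hhi := h.hi
  have hθ := h.pos
  have hs' : (s : ℝ) + 1 ≤ n := by exact_mod_cast hs
  have hs0 : (0 : ℝ) ≤ s := by positivity
  have hinj : ∀ {A B : List (ℕ × ℕ)} {x : ℕ × ℕ}, Lists θ (gap n r θ) (A ++ x :: B) →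
      ((A ++ x :: B).map Prod.fst).idxOf x.1 = A.length := by
    intro A B x hu'
    have hnd := hu'.nodup
    simp only [List.nodup_append, List.nodup_cons, List.mem_cons] at hnd
    have hx := (hu'.mem x).mp (by simp)
    rw [List.map_append, List.map_cons, idxOf_append_cons _ ?_, List.length_map]
    intro hm
    obtain ⟨p, hp, he⟩ := List.mem_map.mp hm
    exact hnd.2.2 p hp x (Or.inl rfl) (h.gap_eq_of_fst ((hu'.mem p).mp (by simp [hp])) hx he)
  have hμ : (s + 1, r + 1) ∈ partialBlock n r θ ℓ s := by
    have := h.two_le'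
    refine mem_partialBlock.mpr ⟨by simp, by simp, ?_, ?_, Or.inl (by simp; omega)⟩ <;>
      push_cast <;> linarith
  obtain ⟨Y, Z, e1, hY, hZ⟩ := hy.split hμ
  have hidx : (y.map Prod.fst).idxOf (s + 1) = Y.length := by
    rw [e1, List.map_append, List.map_cons, idxOf_append_cons _ ?_, List.length_map]
    refine hY.fst_notMem fun j hj => ?_
    obtain ⟨hj1, hj2⟩ := hj
    obtain ⟨h1, h2, h3, h4, -⟩ := mem_partialBlock.mp hj1
    simp only [val_mk] at hj2
    push_cast at h3 hj2
    have : j ≤ r := by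
      by_contra hc
      have := h.mul_le (show r + 1 ≤ j by omega)
      push_cast at this
      linarith
    have := h.mul_le this
    linarith
  have hx : ∀ p ∈ partialBlock n r θ ℓ s, val θ p ≠ val θ (ℓ + s, 1) := by
    intro p hp he
    have := val_injective h.irr he
    subst this
    have := (mem_partialBlock.mp hp).2.2.2.2
    simp at this
  rcases lt_or_ge (val θ (1, r + 1)) (val θ (ℓ, 1)) with hlt | hge
  · obtain ⟨U, V, e2, hU, hV⟩ := hu.split hg1
    obtain ⟨C, W, e3, hC, hW⟩ := hV.split (x := (ℓ, 1)) ⟨hgℓ, hlt⟩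
    have i1 : (u.map Prod.fst).idxOf 1 = U.length := by
      rw [e2] at hu ⊢
      exact hinj hu
    have i2 : (u.map Prod.fst).idxOf ℓ = U.length + (C.length + 1) := by
      have e4 : u = (U ++ (1, r + 1) :: C) ++ (ℓ, 1) :: W := by rw [e2, e3]; simp
      rw [e4] at hu ⊢
      simpa using hinj hu
    simp only [val_mk] at hlt
    push_cast at hlt
    simp only [insertNear, hidx, i1, i2]
    rcases Nat.lt_or_ge (s + 1) n with hsn | hsn
    · have hsn' : (s : ℝ) + 2 ≤ n := by exact_mod_cast hsn
      obtain ⟨C', W', e4, hC', hW'⟩ := hZ.split_threshold (val θ (ℓ + s, 1)) fun p hp => hx p hp.1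
      have hlen := h.translate_of_lt hℓ hC hC' hsn
      -- The final main term `(n, r + 1)` still follows, so the insertion is within the block.
      have hW0 : W' ≠ [] := by
        have : (n, r + 1) ∈ W' := by
          have := h.two_le'
          refine (hW'.mem _).mpr ⟨⟨mem_partialBlock.mpr ⟨by simp; omega, by simp, ?_, ?_,
            Or.inl (by simp; omega)⟩, ?_⟩, ?_⟩ <;> simp only [val_mk] <;> push_cast <;> linarith
        exact List.ne_nil_of_mem this
      have hW0' := List.length_pos_iff.mpr hW0
      have hlm := h.leastMissing_eq_add hℓ hA hy hs (by linarith)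
      refine ⟨(Y ++ (s + 1, r + 1) :: C') ++ (ℓ + s, 1) :: W',
        Lists.insert_partialBlock ?_ ?_ h.irr (by omega) (by linarith) (by linarith), ?_⟩
      · refine ⟨hy.sorted.sublist (by rw [e1, e4]; simp), fun p => ?_⟩
        simp only [List.mem_append, List.mem_cons, hY.mem, hC'.mem, Set.mem_ofPred_eq]
        constructor
        · have hμx : val θ (s + 1, r + 1) < val θ (ℓ + s, 1) := by
            simp only [val_mk]; push_cast; linarith
          rintro (h1 | rfl | h1)
          · exact ⟨h1.1, h1.2.trans hμx⟩
          · exact ⟨hμ, hμx⟩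
          · exact ⟨h1.1.1, h1.2⟩
        · rintro ⟨h1, h2⟩
          rcases lt_trichotomy (val θ p) (val θ (s + 1, r + 1)) with h3 | h3 | h3
          · exact Or.inl ⟨h1, h3⟩
          · exact Or.inr (Or.inl (val_injective h.irr h3))
          · exact Or.inr (Or.inr ⟨⟨h1, h3⟩, h2⟩)
      · refine hW'.congr fun p => ?_
        simp only [Set.mem_ofPred_eq]
        constructor
        · rintro ⟨⟨h1, -⟩, h2⟩
          exact ⟨h1, h2⟩
        · rintro ⟨h1, h2⟩
          refine ⟨⟨h1, lt_trans ?_ h2⟩, h2⟩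
          simp only [val_mk]; push_cast; linarith
      · rw [hlm, if_neg (show ¬ (0 : ℤ) < U.length - ((U.length + (C.length + 1) : ℕ) : ℤ) by
          push_cast; omega), if_pos ?_]
        · rw [e1, e4]
          rw [show Y ++ (s + 1, r + 1) :: (C' ++ W') = (Y ++ (s + 1, r + 1) :: C') ++ W' by simp]
          rw [List.map_append, insertIdx_append_length' _ _ _ (by simp; omega)]
          simp
        · rw [e1, e4]
          simp
          omega
    -- For the last main term, the new pair lies beyond `(n, r + 1)` and nothing is inserted.
    · have hn : s + 1 = n := by omega
      have hn' : (s : ℝ) + 1 = n := by exact_mod_cast hn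
      have hZ0 : Z = [] := List.eq_nil_iff_forall_not_mem.mpr fun p hp => by
        obtain ⟨h1, h2⟩ := (hZ.mem p).mp hp
        have := (mem_partialBlock.mp h1).2.2.2.1
        simp only [val] at h2
        push_cast at h2
        linarith
      refine ⟨y, hy.congr fun p => ?_, ?_⟩
      · simp only [mem_partialBlock]
        refine and_congr_right fun h1 => and_congr_right fun h2 => and_congr_right fun h3 =>
          and_congr_right fun h4 => ⟨fun h5 => h5.imp id (by omega), fun h5 => ?_⟩
        by_contra hc
        have h6 : p.2 = 1 := by omega
        have h7 : p.1 = ℓ + s := by omega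
        rw [h6, h7] at h4
        push_cast at h4
        linarith
      · rw [if_neg (show ¬ (0 : ℤ) < U.length - ((U.length + (C.length + 1) : ℕ) : ℤ) by
          push_cast; omega), if_neg ?_]
        rw [e1, hZ0]
        simp
        omega
  · have hlt : val θ (ℓ, 1) < val θ (1, r + 1) := by
      refine hge.lt_of_ne fun he => ?_
      have := val_injective h.irr he
      simp only [Prod.mk.injEq] at this
      omega
    obtain ⟨U, V, e2, hU, hV⟩ := hu.split hgℓ
    obtain ⟨C, W, e3, hC, hW⟩ := hV.split (x := (1, r + 1)) ⟨hg1, hlt⟩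
    have i1 : (u.map Prod.fst).idxOf ℓ = U.length := by
      rw [e2] at hu ⊢
      exact hinj hu
    have i2 : (u.map Prod.fst).idxOf 1 = U.length + (C.length + 1) := by
      have e4 : u = (U ++ (ℓ, 1) :: C) ++ (1, r + 1) :: W := by rw [e2, e3]; simp
      rw [e4] at hu ⊢
      simpa using hinj hu
    simp only [val_mk] at hlt
    push_cast at hlt
    simp only [insertNear, hidx, i1, i2]
    -- For the first main term, `(ℓ, 1)` precedes the block and is already in `A`.
    rcases Nat.eq_zero_or_pos s with rfl | hspos
    · have hY0 : Y = [] := List.eq_nil_iff_forall_not_mem.mpr fun p hp => by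
        obtain ⟨h1, h2⟩ := (hY.mem p).mp hp
        have := (mem_partialBlock.mp h1).2.2.1
        simp only [val] at h2
        push_cast at h2
        linarith
      refine ⟨y, hy.congr fun p => ?_, ?_⟩
      · simp only [mem_partialBlock]
        refine and_congr_right fun h1 => and_congr_right fun h2 => and_congr_right fun h3 =>
          and_congr_right fun h4 => ⟨fun h5 => h5.imp id (by omega), fun h5 => ?_⟩
        by_contra hc
        have h6 : p.2 = 1 := by omega
        have h7 : p.1 = ℓ := by omega
        rw [h6, h7] at h3
        push_cast at h3
        linarith
      · rw [if_pos (show (0 : ℤ) < ((U.length + (C.length + 1) : ℕ) : ℤ) - U.length by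
          push_cast; omega), if_neg ?_]
        rw [hY0]
        simp
        omega
    · have hs1 : (1 : ℝ) ≤ s := by exact_mod_cast hspos
      obtain ⟨Y', C', e4, hY', hC'⟩ := hY.split_threshold (val θ (ℓ + s, 1)) fun p hp => hx p hp.1
      have hlen := h.translate_of_gt hℓ hC hC' hspos hs
      have hY0 : Y' ≠ [] := by
        have : (1, r + 1) ∈ Y' := by
          have := h.two_le'
          refine (hY'.mem _).mpr ⟨⟨mem_partialBlock.mpr ⟨by simp, by simp, ?_, ?_,
            Or.inl (by simp; omega)⟩, ?_⟩, ?_⟩ <;> simp only [val_mk] <;> push_cast <;> linarith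
        exact List.ne_nil_of_mem this
      have hY0' := List.length_pos_iff.mpr hY0
      have hlm := h.leastMissing_eq_add hℓ hA hy hs (by linarith)
      have hxμ : val θ (ℓ + s, 1) < val θ (s + 1, r + 1) := by
        simp only [val_mk]; push_cast; linarith
      refine ⟨Y' ++ (ℓ + s, 1) :: (C' ++ (s + 1, r + 1) :: Z),
        Lists.insert_partialBlock ?_ ?_ h.irr (by omega) (by linarith) (by linarith), ?_⟩
      · refine hY'.congr fun p => ?_
        simp only [Set.mem_ofPred_eq]
        constructor
        · rintro ⟨⟨h1, -⟩, h2⟩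
          exact ⟨h1, h2⟩
        · rintro ⟨h1, h2⟩
          exact ⟨⟨h1, h2.trans hxμ⟩, h2⟩
      · refine ⟨hy.sorted.sublist (by rw [e1, e4]; simp), fun p => ?_⟩
        simp only [List.mem_append, List.mem_cons, hZ.mem, hC'.mem, Set.mem_ofPred_eq]
        constructor
        · rintro (h1 | rfl | h1)
          · exact ⟨h1.1.1, h1.2⟩
          · exact ⟨hμ, hxμ⟩
          · exact ⟨h1.1, hxμ.trans h1.2⟩
        · rintro ⟨h1, h2⟩
          rcases lt_trichotomy (val θ p) (val θ (s + 1, r + 1)) with h3 | h3 | h3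
          · exact Or.inl ⟨⟨h1, h3⟩, h2⟩
          · exact Or.inr (Or.inl (val_injective h.irr h3))
          · exact Or.inr (Or.inr ⟨h1, h3⟩)
      · rw [hlm, if_pos (show (0 : ℤ) < ((U.length + (C.length + 1) : ℕ) : ℤ) - U.length by
          push_cast; omega), if_pos ?_]
        · rw [e1, e4]
          rw [show Y' ++ C' ++ (s + 1, r + 1) :: Z = Y' ++ (C' ++ (s + 1, r + 1) :: Z) by simp]
          rw [List.map_append, insertIdx_append_length' _ _ _ (by simp; omega)]
          simp
        · rw [e1, e4]
          simp
          omega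

theorem exists_rewriteBlock (h : IsStage n r θ l) (hℓ : ℓ = leastMissing (l.map Prod.fst))
    (hu : Lists θ (gap n r θ) u)
    (hA : Lists θ {p | p ∈ gap n r θ ∧ val θ p < val θ (1, r + 1)} A)
    (hy : Lists θ (partialBlock n r θ ℓ 0) y) :
    ∃ y', Lists θ (partialBlock n r θ ℓ n) y' ∧
      rewriteBlock n (((u.map Prod.fst).idxOf 1 : ℤ) - ((u.map Prod.fst).idxOf ℓ : ℤ))
        ((l ++ A).map Prod.fst) (y.map Prod.fst) = y'.map Prod.fst := by
  suffices H : ∀ s ≤ n, ∃ y', Lists θ (partialBlock n r θ ℓ s) y' ∧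
      ((List.range s).map (· + 1)).foldl
        (insertNear (((u.map Prod.fst).idxOf 1 : ℤ) - ((u.map Prod.fst).idxOf ℓ : ℤ))
          ((l ++ A).map Prod.fst)) (y.map Prod.fst) = y'.map Prod.fst from H n le_rfl
  intro s
  induction s with
  | zero => exact fun _ => ⟨y, hy, by simp⟩
  | succ s ih =>
    intro hs
    obtain ⟨y', h1, h2⟩ := ih (by omega)
    obtain ⟨y'', h3, h4⟩ := h.exists_insertNear hℓ hu hA h1 (by omega)
    refine ⟨y'', h3, ?_⟩
    rw [List.range_succ, List.map_append (f := (· + 1)), List.foldl_append, h2]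
    exact h4

/-- The last block of a stage, translated by `(0, 1)`. -/
theorem exists_lastBlock (h : IsStage n r θ l) (hℓ : ℓ = leastMissing (l.map Prod.fst)) :
    ∃ y, Lists θ (partialBlock n r θ ℓ 0) y ∧ lastBlock (l.map Prod.fst) = y.map Prod.fst := by
  obtain ⟨b1, b2, b3⟩ := h.leastMissing_bounds
  rw [← hℓ] at b1 b2 b3
  have hn := h.two_le
  have hn' := h.two_le_cast
  have hr := h.two_le'
  have hlo := h.lo
  have hhi := h.hi
  obtain ⟨L, R, e1, hL, hR⟩ := h.lists.split (x := (1, r)) (by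
    refine ⟨le_rfl, by simp; omega, ?_⟩
    simp
    omega)
  have hR1 : 1 ∉ R.map Prod.fst := hR.fst_notMem fun j hj => by
    obtain ⟨⟨h1, h2, h3⟩, h4⟩ := hj
    simp only [val_mk, Set.mem_Iic] at h3 h4
    push_cast at h3 h4
    have h6 : r + 1 ≤ j := by
      by_contra hc
      have := h.mul_le (show j ≤ r by omega)
      linarith
    have := h.mul_le h6
    push_cast at this
    linarith
  have h1 := (Lists.singleton θ (1, r)).append hR (by
    rintro p rfl q hq
    exact hq.2)
  refine ⟨_, (h1.map_add (0, 1)).congr fun p => ?_, ?_⟩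
  · simp only [Set.mem_union, Set.mem_singleton_iff, Set.mem_ofPred_eq, seg, Set.mem_Iic, val,
      mem_partialBlock]
    push_cast
    constructor
    · rintro ⟨q, rfl | ⟨⟨h2, h3, h4⟩, h5⟩, rfl⟩
      · simp only [Prod.mk_add_mk]
        push_cast
        refine ⟨by simp, by simp, by linarith, by linarith, Or.inl (by omega)⟩
      · simp only [Prod.fst_add, Prod.snd_add]
        push_cast
        exact ⟨by simpa using h2, by simp, by linarith, by linarith, Or.inl (by simpa using h3)⟩
    · rintro ⟨h2, h3, h4, h5, h6⟩
      have h7 : 2 ≤ p.2 := by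
        by_contra hc
        have h8 : p.2 = 1 := by omega
        have h9 : (p.1 : ℝ) + 1 ≤ ℓ := by exact_mod_cast (show p.1 + 1 ≤ ℓ by omega)
        rw [h8] at h4
        push_cast at h4
        linarith
      have h8 : ((p.2 - 1 : ℕ) : ℝ) = p.2 - 1 := by push_cast [Nat.cast_sub h3]; rfl
      refine ⟨(p.1, p.2 - 1), ?_, by ext <;> simp; omega⟩
      by_cases h9 : p = (1, r + 1)
      · left
        rw [h9]
        simp
      · right
        simp only [h8]
        refine ⟨⟨h2, by omega, by linarith⟩, ?_⟩
        have h10 := (val_injective h.irr).ne h9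
        simp only [val] at h10
        push_cast at h10
        have := lt_of_le_of_ne h4 (Ne.symm h10)
        linarith
  · rw [lastBlock, e1, List.map_append, List.map_cons, afterLast_append_cons _ hR1, List.map_map]
    rfl

/-- The slope may change once, in the merge, before anything is appended. The new stage consists of
the old one, the part of the gap before `(1, r + 1)`, and the full block: after `n` insertions no
pair is missing, because `(ℓ + n, 1)` lies beyond `(n, r + 1)` by `θ < n`. -/
theorem exists_extend (h : IsStage n r θ l) (c : Bool) :
    ∃ θ' l', IsStage n (r + 1) θ' l' ∧ extend n c (l.map Prod.fst) = l'.map Prod.fst := by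
  obtain ⟨θ, u, h, hu, hmerge⟩ := h.exists_merge c
  obtain ⟨b1, b2, b3⟩ := h.leastMissing_bounds
  obtain ⟨ℓ, hℓ⟩ : ∃ ℓ, ℓ = leastMissing (l.map Prod.fst) := ⟨_, rfl⟩
  obtain ⟨y, hy, hlast⟩ := h.exists_lastBlock hℓ
  obtain ⟨A, B, e1, hA, hB⟩ := hu.split h.one_mem_gap
  obtain ⟨y', hy', hrew⟩ := h.exists_rewriteBlock hℓ hu hA hy
  have hr := h.two_le'
  have hlo := h.lo
  have hhi := h.hi
  refine ⟨θ, l ++ A ++ y', ⟨h.two_le, by omega, h.irr, hlo, hhi, ?_⟩, ?_⟩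
  · have h1 := h.lists.append hA fun p hp q hq => lt_of_le_of_lt hp.2.2 hq.1.2.2.1
    refine (h1.append hy' ?_).congr fun p => ?_
    · rintro p hp q hq
      have hq' := (mem_partialBlock.mp hq).2.2.1
      rcases hp with hp | hp
      · have := hp.2.2
        simp only [val, Set.mem_Iic] at this ⊢
        linarith
      · have := hp.2
        simp only [val] at this ⊢
        push_cast at this
        linarith
    · simp only [Set.mem_union, Set.mem_ofPred_eq, mem_gap, mem_partialBlock, seg, Set.mem_Iic, val]
      push_cast
      constructor
      · rintro ((h2 | h2) | h2)
        · exact ⟨h2.1, h2.2.1, by linarith [h2.2.2, h.pos]⟩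
        · exact ⟨h2.1.1, h2.1.2.1, by linarith [h2.1.2.2.2, h.one_lt]⟩
        · exact ⟨h2.1, h2.2.1, h2.2.2.2.1⟩
      · rintro ⟨h2, h3, h4⟩
        rcases le_or_gt ((p.1 : ℝ) + p.2 * θ) (n + r * θ) with h5 | h5
        · exact Or.inl (Or.inl ⟨h2, h3, h5⟩)
        · rcases lt_or_ge ((p.1 : ℝ) + p.2 * θ) (1 + (r + 1) * θ) with h6 | h6
          · exact Or.inl (Or.inr ⟨⟨h2, h3, h5, by linarith⟩, h6⟩)
          · refine Or.inr ⟨h2, h3, h6, h4, ?_⟩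
            by_contra hc
            have h7 : p.2 = 1 := by omega
            have h8 : (ℓ : ℝ) + n ≤ p.1 := by exact_mod_cast (show ℓ + n ≤ p.1 by omega)
            rw [← hℓ] at b2
            rw [h7] at h4
            push_cast at h4
            linarith
  · have htake : (u.map Prod.fst).takeWhile (fun y => y ≠ 1) = A.map Prod.fst := by
      rw [e1, List.map_append, List.map_cons, List.takeWhile_append_of_pos]
      · simp
      · intro i hi
        obtain ⟨p, hp, rfl⟩ := List.mem_map.mp hi
        have hp' := (hA.mem p).mp hp
        simp only [ne_eq, decide_not, Bool.not_eq_eq_eq_not, Bool.not_true, decide_eq_false_iff_not]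
        intro he
        have := h.gap_eq_one hp'.1 he
        rw [this] at hp'
        exact lt_irrefl _ hp'.2
    simp only [extend, hmerge, htake, hlast]
    rw [← hℓ, ← List.map_append, hrew, ← List.map_append]

end IsStage

end Rewriting

/-! ### From the stages to the infinite sequences -/

section Construction

/-- Any irrational slope between `n - 1` and `n` works: these bounds say precisely that `(n + i, 1)`
lies between `(i, 2)` and `(i + 1, 2)`. -/
theorem exists_isStage_zero {n : ℕ} (hn : 2 ≤ n) (c : ℕ → Bool) :
    ∃ θ l, IsStage n 2 θ l ∧ stage n c 0 = l.map Prod.fst := by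
  obtain ⟨θ, hirr, hlo, hhi⟩ := exists_irrational_btwn (show (n : ℝ) - 1 < n by linarith)
  have hn' : (2 : ℝ) ≤ n := by exact_mod_cast hn
  have h0 : 0 < θ := by linarith
  refine ⟨θ, (List.range n).map (fun i => (i + 1, 1)) ++
    (List.range (n - 1)).flatMap (fun i => [(i + 1, 2), (n + (i + 1), 1)]) ++ [(n, 2)],
    ⟨hn, le_rfl, hirr, hlo, hhi, ?_, ?_⟩, ?_⟩
  · simp only [List.pairwise_append, List.pairwise_map, List.pairwise_flatMap, List.mem_append,
      List.mem_map, List.mem_flatMap, List.mem_range, List.mem_cons, List.not_mem_nil, or_false]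
    refine ⟨⟨?_, ⟨?_, ?_⟩, ?_⟩, by simp, ?_⟩
    · refine List.pairwise_lt_range.imp fun {a b} hab => ?_
      have : (a : ℝ) < b := by exact_mod_cast hab
      simpa using this
    · intro i hi
      simp
      linarith
    · refine List.pairwise_lt_range.imp fun {a b} hab => ?_
      have : (a : ℝ) + 1 ≤ b := by exact_mod_cast hab
      rintro p (rfl | rfl) q (rfl | rfl) <;> simp <;> linarith
    · rintro p ⟨i, hi, rfl⟩ q ⟨j, hj, rfl | rfl⟩
      · have : (i : ℝ) + 1 ≤ n := by exact_mod_cast hi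
        simp
        have : (0 : ℝ) ≤ j := by positivity
        linarith
      · have : (i : ℝ) + 1 ≤ n := by exact_mod_cast hi
        simp
        have : (0 : ℝ) ≤ j := by positivity
        linarith
    · rintro p (⟨i, hi, rfl⟩ | ⟨i, hi, rfl | rfl⟩) q rfl
      · have : (i : ℝ) + 1 ≤ n := by exact_mod_cast hi
        simp
        linarith
      · have : (i : ℝ) + 2 ≤ n := by exact_mod_cast (show i + 2 ≤ n by omega)
        simp
        linarith
      · have : (i : ℝ) + 2 ≤ n := by exact_mod_cast (show i + 2 ≤ n by omega)
        simp
        linarith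
  · rintro ⟨i, j⟩
    simp only [List.mem_append, List.mem_map, List.mem_flatMap, List.mem_range, List.mem_cons,
      List.not_mem_nil, or_false, Prod.mk.injEq, seg, Set.mem_ofPred_eq, Set.mem_Iic, val_mk]
    push_cast
    constructor
    · rintro ((⟨k, hk, rfl, rfl⟩ | ⟨k, hk, ⟨rfl, rfl⟩ | ⟨rfl, rfl⟩⟩) | ⟨rfl, rfl⟩)
      · have : (k : ℝ) + 1 ≤ n := by exact_mod_cast hk
        refine ⟨by omega, le_rfl, ?_⟩
        push_cast
        linarith
      · have : (k : ℝ) + 2 ≤ n := by exact_mod_cast (show k + 2 ≤ n by omega)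
        refine ⟨by omega, by omega, ?_⟩
        push_cast
        linarith
      · have : (k : ℝ) + 2 ≤ n := by exact_mod_cast (show k + 2 ≤ n by omega)
        refine ⟨by omega, le_rfl, ?_⟩
        push_cast
        linarith
      · exact ⟨by omega, by omega, by push_cast; linarith⟩
    · rintro ⟨h1, h2, h3⟩
      have h1' : (1 : ℝ) ≤ i := by exact_mod_cast h1
      have hj : j ≤ 2 := by
        by_contra hc
        have := natCast_mul_le h0 (show 3 ≤ j by omega)
        push_cast at this
        linarith
      obtain rfl | rfl : j = 1 ∨ j = 2 := by omega
      · push_cast at h3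
        have h4 : (i : ℝ) < 2 * n := by linarith
        have h5 : i < 2 * n := by exact_mod_cast h4
        rcases Nat.lt_or_ge n i with h6 | h6
        · exact Or.inl (Or.inr ⟨i - n - 1, by omega, Or.inr ⟨by omega, rfl⟩⟩)
        · exact Or.inl (Or.inl ⟨i - 1, by omega, by omega, rfl⟩)
      · push_cast at h3
        have h4 : (i : ℝ) ≤ n := by linarith
        have h5 : i ≤ n := by exact_mod_cast h4
        rcases h5.lt_or_eq with h6 | h6
        · exact Or.inl (Or.inr ⟨i - 1, by omega, Or.inl ⟨by omega, rfl⟩⟩)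
        · exact Or.inr ⟨h6, rfl⟩
  · simp only [stage, firstBlock, List.map_append, List.map_map, List.map_flatMap, List.map_cons,
      List.map_nil]
    rfl

theorem exists_isStage {n : ℕ} (hn : 2 ≤ n) (c : ℕ → Bool) (k : ℕ) :
    ∃ θ l, IsStage n (k + 2) θ l ∧ stage n c k = l.map Prod.fst := by
  induction k with
  | zero => exact exists_isStage_zero hn c
  | succ k ih =>
    obtain ⟨θ, l, h1, h2⟩ := ih
    obtain ⟨θ', l', h3, h4⟩ := h1.exists_extend (c k)
    exact ⟨θ', l', h3, by rw [stage, h2, h4]⟩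

/-- The second components in a stage count the occurrences of the first components. -/
theorem IsStage.snd_eq_occ {n r : ℕ} {θ : ℝ} {l : List (ℕ × ℕ)} (h : IsStage n r θ l)
    {S : ℕ → ℕ} (hS : ∀ i, ∀ hi : i < l.length, S i = l[i].1) {k : ℕ} (hk : k < l.length) :
    l[k] = (S k, occ S k) := by
  refine Prod.ext (hS k hk).symm ?_
  have hlt : ∀ i j, ∀ hi : i < l.length, ∀ hj : j < l.length, i < j →
      val θ l[i] < val θ l[j] := fun i j hi hj hij =>
    List.pairwise_iff_getElem.mp h.lists.sorted i j hi hj hij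
  have hmem := h.mem.mp (List.getElem_mem hk)
  have hθ := h.pos
  simp only
  have : (Finset.Icc 1 l[k].2).card = occ S k := by
    rw [occ]
    symm
    -- The occurrences of a value up to index `k` correspond to the rows `1, …, l[k].2` of its
    -- column. The default `(0, 0)` is never used, as all indices are within the list.
    refine Finset.card_bij (fun i hi => (l[i]?.getD (0, 0)).2) ?_ ?_ ?_
    · intro i hi
      simp only [Finset.mem_filter, Finset.mem_range] at hi
      have hi' : i < l.length := by omega
      have h1 := (h.mem.mp (List.getElem_mem hi')).2.1
      simp only [List.getElem?_eq_getElem hi', Option.getD_some, Finset.mem_Icc]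
      refine ⟨h1, ?_⟩
      rcases (show i ≤ k by omega).lt_or_eq with h2 | h2
      · have h3 := hlt i k hi' hk h2
        have h4 : l[i].1 = l[k].1 := by rw [← hS i hi', ← hS k hk]; exact hi.2
        simp only [val, h4] at h3
        have h5 : (l[i].2 : ℝ) < l[k].2 := lt_of_mul_lt_mul_right (by linarith) hθ.le
        exact (by exact_mod_cast h5 : l[i].2 < l[k].2).le
      · subst h2; exact le_rfl
    · intro i hi j hj he
      simp only [Finset.mem_filter, Finset.mem_range] at hi hj
      have hi' : i < l.length := by omega
      have hj' : j < l.length := by omega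
      simp only [List.getElem?_eq_getElem hi', List.getElem?_eq_getElem hj', Option.getD_some] at he
      have h4 : l[i].1 = l[j].1 := by rw [← hS i hi', ← hS j hj', hi.2, hj.2]
      exact (List.Nodup.getElem_inj_iff h.lists.nodup).mp (Prod.ext h4 he)
    · intro b hb
      simp only [Finset.mem_Icc] at hb
      have h1 := h.mul_le hb.2
      obtain ⟨i, hi, hib⟩ := List.mem_iff_getElem.mp
        (h.mem.mpr (show _ ∧ _ ∧ _ from ⟨hmem.1, hb.1, by
          show ((l[k].1 : ℕ) : ℝ) + (b : ℕ) * θ ≤ _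
          linarith [hmem.2.2]⟩) : (l[k].1, b) ∈ l)
      refine ⟨i, ?_, by simp [List.getElem?_eq_getElem hi, hib]⟩
      simp only [Finset.mem_filter, Finset.mem_range]
      refine ⟨?_, by rw [hS i hi, hib, hS k hk]⟩
      by_contra hc
      have h2 := hlt k i hk hi (by omega)
      rw [hib] at h2
      simp only [val] at h2
      linarith
  rw [← this]
  simp

theorem IsStage.le_length {n r : ℕ} {θ : ℝ} {l : List (ℕ × ℕ)} (h : IsStage n r θ l) :
    r ≤ l.length := by
  have hn := h.two_le_cast
  have hsub : ((List.range r).map fun i => (1, i + 1)) ⊆ l := by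
    intro p hp
    simp only [List.mem_map, List.mem_range] at hp
    obtain ⟨i, hi, rfl⟩ := hp
    have := h.mul_le (show i + 1 ≤ r from hi)
    refine h.mem.mpr ⟨le_rfl, by simp, ?_⟩
    push_cast at this ⊢
    linarith
  have hnd : ((List.range r).map fun i => (1, i + 1)).Nodup :=
    List.nodup_range.map fun a b hab => by simpa using hab
  simpa using (hnd.subperm hsub).length_le

/-- The pairs do not depend on the stage, since second components are occurrence counts. Four
indices fit into one stage, where the additivity of `val` gives the invariance, whatever the slope
of that stage. -/
theorem ConstructedFirst.isInvariantEnum {n : ℕ} (hn : 2 ≤ n) {S : ℕ → ℕ}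
    (hS : ConstructedFirst n S) : IsInvariantEnum fun h => (S h, occ S h) := by
  obtain ⟨c, hc⟩ := hS
  -- Every initial segment is contained in a stage for some slope.
  have key : ∀ k, ∃ θ l, IsStage n (k + 2) θ l ∧ k + 2 ≤ l.length ∧
      ∀ i, ∀ hi : i < l.length, l[i] = (S i, occ S i) := by
    intro k
    obtain ⟨θ, l, h1, h2⟩ := exists_isStage hn c k
    refine ⟨θ, l, h1, h1.le_length, fun i hi => h1.snd_eq_occ (fun i hi => ?_) hi⟩
    rw [hc k i (by rw [h2]; simpa using hi)]
    simp [h2]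
  have hcmp : ∀ {l : List (ℕ × ℕ)} {r : ℕ} {θ : ℝ}, IsStage n r θ l →
      (∀ i, ∀ hi : i < l.length, l[i] = (S i, occ S i)) → ∀ i j, i < l.length → j < l.length →
      (i < j ↔ val θ (S i, occ S i) < val θ (S j, occ S j)) := by
    intro l r θ h1 h2 i j hi hj
    have mono : ∀ i j, i < l.length → j < l.length → i < j →
        val θ (S i, occ S i) < val θ (S j, occ S j) := fun i j hi hj hij => by
      rw [← h2 i hi, ← h2 j hj]
      exact List.pairwise_iff_getElem.mp h1.lists.sorted i j hi hj hij
    refine ⟨mono i j hi hj, fun hlt => ?_⟩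
    rcases lt_trichotomy i j with h3 | h3 | h3
    · exact h3
    · subst h3; exact absurd hlt (lt_irrefl _)
    · exact absurd hlt (mono j i hj hi h3).not_gt
  have hinv : ∀ u : ℕ × ℕ, ∀ h k h' k', (S h', occ S h') = (S h, occ S h) + u →
      (S k', occ S k') = (S k, occ S k) + u → h < k → h' < k' := by
    intro u h k h' k' e1 e2 hlt
    obtain ⟨θ, l, h1, h2, h3⟩ := key (h + k + h' + k')
    rw [hcmp h1 h3 h' k' (by omega) (by omega), e1, e2, val_add, val_add]
    have := (hcmp h1 h3 h k (by omega) (by omega)).mp hlt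
    linarith
  refine ⟨⟨fun h _ => ?_, (occ_injective S).injOn, ?_⟩, ?_, hinv (1, 0), hinv (0, 1)⟩
  · obtain ⟨θ, l, h1, h2, h3⟩ := key h
    have := h1.mem.mp (List.getElem_mem (show h < l.length by omega))
    rw [h3] at this
    exact ⟨this.1, this.2.1⟩
  · rintro ⟨i, j⟩ ⟨hi, hj⟩
    simp only at hi hj
    obtain ⟨θ, l, h1, h2, h3⟩ := key (i + j)
    have hm : (i, j) ∈ l := by
      refine h1.mem.mpr ⟨hi, hj, ?_⟩
      have := h1.one_lt
      have h4 : (i : ℝ) ≤ i * θ := le_mul_of_one_le_right (by positivity) this.le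
      push_cast
      have := h1.two_le_cast
      linarith
    obtain ⟨k, hk, hk'⟩ := List.mem_iff_getElem.mp hm
    exact ⟨k, Set.mem_univ _, by rw [← hk', h3 k hk]⟩
  · have h0 := hc 0 0
    rw [stage, firstBlock] at h0
    have h1 : S 0 = 1 := by
      rw [h0 (by simp)]
      obtain ⟨m, rfl⟩ : ∃ m, n = m + 1 := ⟨n - 1, by omega⟩
      simp [List.range_succ_eq_map]
    simp [h1, occ, Finset.filter_singleton]

theorem ConstructedFirst.initial {n : ℕ} (hn : 2 ≤ n) {S : ℕ → ℕ} (hS : ConstructedFirst n S) :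
    (∀ k < n, S k = k + 1) ∧ S n = 1 := by
  obtain ⟨c, hc⟩ := hS
  have h0 := hc 0
  rw [stage, firstBlock] at h0
  constructor
  · intro k hk
    rw [h0 k (by simp; omega), List.getElem_append_left (by simp; omega),
      List.getElem_append_left (by simpa using hk)]
    simp
  · obtain ⟨m, rfl⟩ : ∃ m, n = m + 2 := ⟨n - 2, by omega⟩
    rw [h0 (m + 2) (by simp), List.getElem_append_left (by simp),
      List.getElem_append_right (by simp)]
    simp [List.range_succ_eq_map]

/-- The prescribed beginning, `n` ones and a `2`, agrees with counting occurrences in `1, 2, …, n,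
1`. -/
theorem ConstructedSecond.exists_eq_occ {n : ℕ} (hn : 2 ≤ n) {S : ℕ → ℕ}
    (hS : ConstructedSecond n S) : ∃ S', ConstructedFirst n S' ∧ S = occ S' := by
  obtain ⟨S', h1, h2, h3, h4⟩ := hS
  refine ⟨S', h1, funext fun k => ?_⟩
  obtain ⟨i1, i2⟩ := h1.initial hn
  rcases lt_trichotomy k n with hk | rfl | hk
  · rw [h2 k hk, occ, eq_comm, Finset.card_eq_one]
    refine ⟨k, Finset.ext fun i => ?_⟩
    simp only [Finset.mem_filter, Finset.mem_range, Finset.mem_singleton]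
    constructor
    · rintro ⟨h5, h6⟩
      rw [i1 i (by omega), i1 k hk] at h6
      omega
    · rintro rfl
      simp
  · rw [h3, occ, eq_comm, Finset.card_eq_two]
    refine ⟨0, k, by omega, Finset.ext fun i => ?_⟩
    simp only [Finset.mem_filter, Finset.mem_range, Finset.mem_insert, Finset.mem_singleton, i2]
    constructor
    · rintro ⟨h5, h6⟩
      by_contra hc
      rw [i1 i (by omega)] at h6
      omega
    · rintro (rfl | rfl)
      · exact ⟨by omega, by simpa using i1 0 (by omega)⟩
      · exact ⟨by omega, i2⟩
  · exact h4 k hk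

theorem IsConstructed.exists_isSignature {S : ℕ → ℕ} (hS : IsConstructed S) :
    ∃ θ : ℝ, 0 < θ ∧ IsSignature θ S := by
  obtain ⟨n, hn, hS | hS⟩ := hS
  · obtain ⟨θ, hθ, h⟩ := (hS.isInvariantEnum hn).exists_signatureWith
    exact ⟨θ, hθ, occ S, h⟩
  · obtain ⟨S', h1, rfl⟩ := hS.exists_eq_occ hn
    obtain ⟨θ, hθ, h⟩ := (h1.isInvariantEnum hn).exists_signatureWith
    exact ⟨1 / θ, by positivity, S', h.swap hθ⟩

end Construction

end Kimberling

theorem theorem10 :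
    (∀ S : ℕ → ℕ, Kimberling.IsConstructed S → ∃ θ : ℝ, 0 < θ ∧ Kimberling.IsSignature θ S) ∧
    (∀ S : ℕ → ℕ, Kimberling.IsDoublyFractal S ↔ ∃ θ : ℝ, 0 < θ ∧ Kimberling.IsSignature θ S) :=
  ⟨fun _ hS => hS.exists_isSignature, Kimberling.isDoublyFractal_iff⟩
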